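/- Let $\nu$ be a positive integer, let $b>0$ and let $1<\alpha<1+\frac{1}{\nu+1}$. Put $z=\frac{(\alpha-1)b^2}{4}$. Let $(a)_r=a(a+1)\cdots(a+r-1)$, $(a)_0=1$, let $\psi=\Gamma'/\Gamma$, and let ${}_1F_2(a;c,d;x)=\sum_{r\ge 0}\frac{(a)_r}{(c)_r(d)_r}\frac{x^r}{r!}$. Then the extended non-resonant integral $$I_{1\alpha}=\int_0^\infty x^{\nu}\,[1+(\alpha-1)x]^{-\frac1{\alpha-1}}\,e^{-bx^{-1/2}}\,dx$$ converges, the two infinite series below converge absolutely, and $$I_{1\alpha}=\frac{\pi^{-1/2}}{(\alpha-1)^{\nu+1}\,\Gamma\!\left(\frac1{\alpha-1}\right)}\left\{R_1+R_2+R_3\right\},$$ where $$R_1=\pi^{1/2}\,\Gamma\!\left(\tfrac1{\alpha-1}-1-\nu\right)\Gamma(1+\nu)\sum_{r=0}^{\nu}\frac{(-1)^r}{r!}\,\frac{\left(\frac1{\alpha-1}-1-\nu\right)_r}{\left(\frac12\right)_r(-\nu)_r}\,z^r,$$ $$R_2=-2\pi^{1/2}\,\Gamma\!\left(\tfrac1{\alpha-1}-\tfrac12-\nu\right)\Gamma\!\left(\tfrac12+\nu\right)z^{1/2}\;{}_1F_2\!\left(\tfrac1{\alpha-1}-\tfrac12-\nu;\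 \tfrac32,\ \tfrac12-\nu;\ -z\right),$$ $$R_3=z^{1+\nu}\sum_{r=0}^{\infty}z^r\left[-\ln z+A_r\right]B_r,$$ with $$A_r=\psi\!\left(-\tfrac12-\nu-r\right)-\psi\!\left(\tfrac1{\alpha-1}+r\right)+\psi(1+r)+\psi(2+\nu+r),$$ $$B_r=\frac{(-1)^{1+\nu+r}\,\Gamma\!\left(-\frac12-\nu\right)\Gamma\!\left(\frac1{\alpha-1}\right)\left(\frac1{\alpha-1}\right)_r}{\left(\frac32+\nu\right)_r\,r!\,(1+\nu+r)!}.$$ -/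

import Mathlib

open MeasureTheory Set

noncomputable section

namespace Thermonuclear

/-- The rising factorial `(a)_r = a (a + 1) ⋯ (a + r - 1)`, with `(a)_0 = 1`. -/
def rising (a : ℝ) (r : ℕ) : ℝ := ∏ i ∈ Finset.range r, (a + i)

/-- The psi function `ψ(x) = Γ'(x) / Γ(x)` on the real line. -/
def psi (x : ℝ) : ℝ := deriv Real.Gamma x / Real.Gamma x

/-- The `r`-th term `(a)_r / ((c)_r (d)_r) * x ^ r / r!` of the series `₁F₂(a; c, d; x)`. -/
def oneFTwoTerm (a c d x : ℝ) (r : ℕ) : ℝ :=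
  rising a r / (rising c r * rising d r) * (x ^ r / (r.factorial : ℝ))

/-- The generalized hypergeometric function `₁F₂(a; c, d; x)`. -/
def oneFTwo (a c d x : ℝ) : ℝ := ∑' r : ℕ, oneFTwoTerm a c d x r

/-- The integrand `x ^ ν [1 + (α - 1) x] ^ (-1 / (α - 1)) exp (-b x ^ (-1 / 2))` of the extended
non-resonant integral. -/
def integrand (ν : ℕ) (α b x : ℝ) : ℝ :=
  x ^ ν * (1 + (α - 1) * x) ^ (-(1 / (α - 1))) * Real.exp (-b * x ^ (-(1 / 2) : ℝ))

/-- The extended non-resonant integral `I_{1α}`. -/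
def I₁ (ν : ℕ) (α b : ℝ) : ℝ := ∫ x in Ioi (0 : ℝ), integrand ν α b x

/-- `A_r = ψ(-1/2 - ν - r) - ψ(1 / (α - 1) + r) + ψ(1 + r) + ψ(2 + ν + r)`. -/
def A (ν : ℕ) (α : ℝ) (r : ℕ) : ℝ :=
  psi (-(1 / 2) - ν - r) - psi (1 / (α - 1) + r) + psi (1 + r) + psi (2 + ν + r)

/-- `B_r = (-1)^(1 + ν + r) Γ(-1/2 - ν) Γ(1 / (α - 1)) (1 / (α - 1))_r
/ ((3/2 + ν)_r r! (1 + ν + r)!)`. -/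
def B (ν : ℕ) (α : ℝ) (r : ℕ) : ℝ :=
  (-1) ^ (1 + ν + r) * Real.Gamma (-(1 / 2) - ν) * Real.Gamma (1 / (α - 1))
      * rising (1 / (α - 1)) r
    / (rising (3 / 2 + ν) r * (r.factorial : ℝ) * ((1 + ν + r).factorial : ℝ))

/-- The `r`-th term `z ^ r [-ln z + A_r] B_r` of the logarithmic series. -/
def logTerm (ν : ℕ) (α z : ℝ) (r : ℕ) : ℝ :=
  z ^ r * (-Real.log z + A ν α r) * B ν α r

end Thermonuclear

end

/-!
Put `a = 1 / (α - 1)` and `y = 2 √z`. The substitution `t = (α - 1) x` turns the integral, up to a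
power of `α - 1`, into `J = ∫₀^∞ t ^ ν (1 + t) ^ (-a) exp (-y t ^ (-1 / 2)) dt`, and the claim is an
expansion of `J` in powers of `y` with a logarithm. The proof is real-variable and needs no
Mellin–Barnes contour.

Fix `0 < c < 1` and cut the integral at `c`. On `(c, ∞)` the exponential may be expanded in powers
of `y`, on `(0, c]` the binomial factor may be expanded in powers of `t`. The `k`-th term of the
first expansion is a truncated beta integral with exponent `p = ν + 1 - k / 2`; the `m`-th term of
the second is, after `v = y t ^ (-1 / 2)`, a truncated gamma integral with exponent `-2 (ν + 1 + m)`.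
Either truncated integral equals its *finite part* (`finitePart`) minus a series in powers of the
cut-off. In the sum of the two expansions these series form one absolutely convergent double
series, which occurs twice with opposite signs and cancels (`exists_hasSum_powPart_logPart`). What
remains is the sum of the finite parts, which do not depend on `c` except for terms in `log c` that
cancel as well.

The finite parts are computed by integration by parts (`mul_finitePart_add_finitePart_deriv`), which
moves the exponent up by one. Away from the poles one ends at a convergent integral, and the finite
part is `Γ(p) Γ(a - p) / Γ(a)` (`betaPart_of_ne`). At a pole one ends at exponent `0`, where the
finite part is the derivative at `0` of `p` times the Mellin transform (`finitePart_zero_add_log`);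
this is the source of the `ψ`-values (`betaPart_neg_natCast`, `gammaPart_neg_natCast`).

Finally the powers of `y` are sorted: even powers below `2 (ν + 1)` give the finite sum, odd powers
give the `₁F₂` series, and even powers from `2 (ν + 1)` on, which meet the poles, combine with the
gamma finite parts to the logarithmic series. Convergence of the two infinite series is inherited
from the two expansions.
-/

noncomputable section

namespace Thermonuclear

open Filter Topology

/-! ### Finite parts of Mellin integrals -/

/-- The finite part of `∫₀^∞ t ^ (p - 1) f t dt` for a function with `f t = ∑ b m * t ^ m` on
`(0, c]`: the part over `(0, c]` is replaced by the termwise integrated series. The convention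
`x / 0 = 0` drops the term of index `m = -p`; that term would contribute `b m * log c`, which is
not included here. -/
def finitePart (f : ℝ → ℝ) (b : ℕ → ℝ) (c p : ℝ) : ℝ :=
  (∫ t in Ioi c, t ^ (p - 1) * f t) + ∑' m : ℕ, b m * (c ^ (p + m) / (p + m))

/-- The reciprocals `1 / (p + m)` are bounded in `m`; a vanishing denominator contributes `0`. -/
lemma exists_abs_inv_add_natCast_le (p : ℝ) : ∃ K, ∀ m : ℕ, |(p + m)⁻¹| ≤ K := by
  have h : Tendsto (fun m : ℕ ↦ |(p + m)⁻¹|) atTop (𝓝 |0|) :=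
    (tendsto_inv_atTop_zero.comp
      (tendsto_atTop_add_const_left _ p tendsto_natCast_atTop_atTop)).abs
  obtain ⟨K, hK⟩ := h.bddAbove_range
  exact ⟨K, fun m ↦ hK ⟨m, rfl⟩⟩

lemma summable_mul_rpow_div {b : ℕ → ℝ} {c : ℝ} (hc : 0 < c)
    (hb : Summable fun m ↦ b m * c ^ m) (p : ℝ) :
    Summable fun m : ℕ ↦ b m * (c ^ (p + m) / (p + m)) := by
  obtain ⟨K, hK⟩ := exists_abs_inv_add_natCast_le p
  refine Summable.of_norm_bounded (hb.norm.mul_right (c ^ p * K)) fun m ↦ ?_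
  rw [Real.rpow_add hc, Real.rpow_natCast, div_eq_mul_inv, ← mul_assoc]
  calc ‖b m * (c ^ p * c ^ m) * (p + m)⁻¹‖
      = ‖b m * c ^ m‖ * (c ^ p * |(p + m)⁻¹|) := by
        simp only [norm_mul, Real.norm_eq_abs, abs_of_pos (Real.rpow_pos_of_pos hc p)]; ring
    _ ≤ _ := by gcongr; exact hK m

lemma integrableOn_Ioc_rpow {c s : ℝ} (hc : 0 < c) (hs : -1 < s) :
    IntegrableOn (fun t : ℝ ↦ t ^ s) (Ioc 0 c) :=
  (intervalIntegrable_iff_integrableOn_Ioc_of_le hc.le).1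
    (intervalIntegral.intervalIntegrable_rpow' hs)

lemma integral_Ioc_rpow {c s : ℝ} (hc : 0 < c) (hs : -1 < s) :
    ∫ t in Ioc 0 c, t ^ s = c ^ (s + 1) / (s + 1) := by
  rw [← intervalIntegral.integral_of_le hc.le, integral_rpow (Or.inl hs),
    Real.zero_rpow (by linarith), sub_zero]

/-- Termwise integration of a power series against `t ^ (p - 1)`. -/
lemma integral_Ioc_rpow_mul_eq_tsum {f : ℝ → ℝ} {b : ℕ → ℝ} {c p : ℝ} (hc : 0 < c) (hp : 0 < p)
    (hf : ∀ t ∈ Ioc 0 c, HasSum (fun m ↦ b m * t ^ m) (f t)) :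
    ∫ t in Ioc 0 c, t ^ (p - 1) * f t = ∑' m : ℕ, b m * (c ^ (p + m) / (p + m)) := by
  have hb : Summable fun m ↦ b m * c ^ m := (hf c ⟨hc, le_rfl⟩).summable
  have hs (m : ℕ) : -1 < p - 1 + m := by have : (0 : ℝ) ≤ m := m.cast_nonneg; linarith
  have hint (m : ℕ) : ∫ t in Ioc 0 c, t ^ (p - 1 + m) = c ^ (p + m) / (p + m) := by
    rw [integral_Ioc_rpow hc (hs m)]; ring_nf
  have key := hasSum_integral_of_summable_integral_norm (μ := volume.restrict (Ioc 0 c))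
    (F := fun (m : ℕ) (t : ℝ) ↦ b m * t ^ (p - 1 + m))
    (fun m ↦ (integrableOn_Ioc_rpow hc (hs m)).const_mul _) (by
      have : ∀ m : ℕ, ∫ t in Ioc 0 c, ‖b m * t ^ (p - 1 + m)‖
          = ‖b m * (c ^ (p + m) / (p + m))‖ := fun m ↦ by
        have h0 : 0 ≤ c ^ (p + m) / (p + m) := by positivity
        rw [norm_mul, Real.norm_of_nonneg h0, ← hint m, ← integral_const_mul]
        refine setIntegral_congr_fun measurableSet_Ioc fun t ht ↦ ?_
        simp only [norm_mul]
        rw [Real.norm_of_nonneg (Real.rpow_nonneg ht.1.le _)]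
      simp_rw [this]
      exact (summable_mul_rpow_div hc hb p).norm)
  simp only [integral_const_mul, hint] at key
  rw [key.tsum_eq]
  refine setIntegral_congr_fun measurableSet_Ioc fun t ht ↦ ?_
  rw [← (hf t ht).tsum_eq, ← tsum_mul_left]
  refine tsum_congr fun m ↦ ?_
  rw [Real.rpow_add ht.1, Real.rpow_natCast]; ring

lemma finitePart_eq_integral {f : ℝ → ℝ} {b : ℕ → ℝ} {c p : ℝ} (hc : 0 < c) (hp : 0 < p)
    (hf : ∀ t ∈ Ioc 0 c, HasSum (fun m ↦ b m * t ^ m) (f t))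
    (hint : IntegrableOn (fun t ↦ t ^ (p - 1) * f t) (Ioi 0)) :
    finitePart f b c p = ∫ t in Ioi 0, t ^ (p - 1) * f t := by
  rw [finitePart, ← integral_Ioc_rpow_mul_eq_tsum hc hp hf, add_comm,
    ← setIntegral_union (Ioc_disjoint_Ioi le_rfl) measurableSet_Ioi
      (hint.mono_set Ioc_subset_Ioi_self) (hint.mono_set (Ioi_subset_Ioi hc.le)),
    Ioc_union_Ioi_eq_Ioi hc.le]

/-- Integration by parts for finite parts. The boundary terms at `c` of the integral and of the
series cancel, except that the series misses the term of index `m = -p` when there is one. -/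
lemma mul_finitePart_add_finitePart_deriv {f f' : ℝ → ℝ} {b b' : ℕ → ℝ} {c p : ℝ} (hc : 0 < c)
    (hf : HasSum (fun m ↦ b m * c ^ m) (f c))
    (hf' : Summable fun m ↦ b' m * c ^ m)
    (hb' : ∀ m, b' m = (m + 1) * b (m + 1))
    (hderiv : ∀ t ∈ Ici c, HasDerivAt f (f' t) t)
    (hint : IntegrableOn (fun t ↦ t ^ (p - 1) * f t) (Ioi c))
    (hint' : IntegrableOn (fun t ↦ t ^ p * f' t) (Ioi c))
    (hlim : Tendsto (fun t ↦ t ^ p * f t) atTop (𝓝 0)) :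
    p * finitePart f b c p + finitePart f' b' c (p + 1)
      = -∑' m : ℕ, if p + m = 0 then b m else 0 := by
  have htail : p * (∫ t in Ioi c, t ^ (p - 1) * f t) + ∫ t in Ioi c, t ^ p * f' t
      = -(c ^ p * f c) := by
    have h1 : IntegrableOn (fun t ↦ p * (t ^ (p - 1) * f t)) (Ioi c) := hint.const_mul p
    rw [← integral_const_mul, ← integral_add h1 hint', ← zero_sub]
    refine integral_Ioi_of_hasDerivAt_of_tendsto' (f := fun t ↦ t ^ p * f t) (fun t ht ↦ ?_)
      (h1.add hint') hlim
    have ht0 : t ≠ 0 := (hc.trans_le ht).ne'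
    exact ((Real.hasDerivAt_rpow_const (p := p) (Or.inl ht0)).mul (hderiv t ht)).congr_deriv
      (by ring)
  have hA := summable_mul_rpow_div hc hf.summable p
  have hB : Summable fun m : ℕ ↦ b m * c ^ (p + m) := by
    refine (hf.summable.mul_left (c ^ p)).congr fun m ↦ ?_
    rw [Real.rpow_add hc, Real.rpow_natCast]; ring
  have hBsum : ∑' m : ℕ, b m * c ^ (p + m) = c ^ p * f c := by
    rw [← hf.tsum_eq, ← tsum_mul_left]
    refine tsum_congr fun m ↦ ?_
    rw [Real.rpow_add hc, Real.rpow_natCast]; ring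
  have hC := summable_mul_rpow_div hc hf' (p + 1)
  -- the series for `f'`, written with the index of the series for `f`
  have hshift (m : ℕ) : b' m * (c ^ (p + 1 + m) / (p + 1 + m))
      = ((m + 1 : ℕ) : ℝ) * (b (m + 1) * (c ^ (p + (m + 1 : ℕ)) / (p + (m + 1 : ℕ)))) := by
    have : p + 1 + (m : ℝ) = p + (m + 1 : ℕ) := by push_cast; ring
    rw [this, hb' m]; push_cast; ring
  have hD : Summable fun m : ℕ ↦ (m : ℝ) * (b m * (c ^ (p + m) / (p + m))) := by
    rw [← summable_nat_add_iff 1]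
    exact hC.congr hshift
  have hDsum : ∑' m : ℕ, b' m * (c ^ (p + 1 + m) / (p + 1 + m))
      = ∑' m : ℕ, (m : ℝ) * (b m * (c ^ (p + m) / (p + m))) := by
    rw [hD.tsum_eq_zero_add, tsum_congr hshift]; simp
  have hpole (m : ℕ) : p * (b m * (c ^ (p + m) / (p + m)))
      = b m * c ^ (p + m) - (m : ℝ) * (b m * (c ^ (p + m) / (p + m)))
        - (if p + m = 0 then b m else 0) := by
    split_ifs with h
    · simp [h]
    · field_simp; ring
  have hE : Summable fun m : ℕ ↦ if p + m = 0 then b m else 0 := by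
    refine ((hB.sub hD).sub (hA.mul_left p)).congr fun m ↦ ?_
    rw [hpole m]; ring
  have hsum : p * ∑' m : ℕ, b m * (c ^ (p + m) / (p + m))
      = c ^ p * f c - (∑' m : ℕ, (m : ℝ) * (b m * (c ^ (p + m) / (p + m))))
        - ∑' m : ℕ, if p + m = 0 then b m else 0 := by
    rw [← tsum_mul_left, tsum_congr hpole, (hB.sub hD).tsum_sub hE, hB.tsum_sub hD, hBsum]
  rw [finitePart, finitePart, hDsum, add_sub_cancel_right]
  linear_combination htail + hsum

/-- The finite part at the pole `p = 0`: if the finite part is `D p / p` for small `p > 0`, then the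
constant term at `0` is `D' 0`. Only the term of index `0` of the series is singular at `p = 0`,
and `(c ^ p - 1) / p → log c`. -/
lemma finitePart_zero_add_log {f : ℝ → ℝ} {b : ℕ → ℝ} {c δ d : ℝ} {D : ℝ → ℝ} (hc : 0 < c)
    (hδ : 0 < δ) (hb : Summable fun m ↦ b m * c ^ m)
    (hint₀ : IntegrableOn (fun t ↦ t ^ ((0 : ℝ) - 1) * f t) (Ioi c))
    (hint : IntegrableOn (fun t ↦ t ^ (δ - 1) * f t) (Ioi c))
    (hD : ∀ p ∈ Ioo 0 δ, finitePart f b c p = D p / p) (hD0 : D 0 = b 0)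
    (hderiv : HasDerivAt D d 0) :
    finitePart f b c 0 + b 0 * Real.log c = d := by
  have hev : ∀ᶠ p in 𝓝[>] (0 : ℝ), p ∈ Ioo 0 δ := Ioo_mem_nhdsGT hδ
  have hpow : HasDerivAt (fun p : ℝ ↦ c ^ p) (Real.log c) 0 := by
    simpa using (Real.hasStrictDerivAt_const_rpow hc 0).hasDerivAt
  -- the tail integral is continuous at `0` from the right
  have h1 : Tendsto (fun p : ℝ ↦ (∫ t in Ioi c, t ^ (p - 1) * f t)) (𝓝[>] 0)
      (𝓝 (∫ t in Ioi c, t ^ ((0 : ℝ) - 1) * f t)) := by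
    refine tendsto_integral_filter_of_dominated_convergence
      (fun t ↦ ‖t ^ ((0 : ℝ) - 1) * f t‖ + ‖t ^ (δ - 1) * f t‖) ?_ ?_
      (hint₀.norm.add hint.norm) ?_
    · refine Eventually.of_forall fun p ↦ ?_
      have : AEStronglyMeasurable (fun t : ℝ ↦ t ^ p * (t ^ ((0 : ℝ) - 1) * f t))
          (volume.restrict (Ioi c)) :=
        (by fun_prop : Measurable fun t : ℝ ↦ t ^ p).aestronglyMeasurable.mul hint₀.1
      refine this.congr ((ae_restrict_mem measurableSet_Ioi).mono fun t ht ↦ ?_)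
      simp only
      rw [← mul_assoc, ← Real.rpow_add (hc.trans ht)]; ring_nf
    · filter_upwards [hev] with p hp
      refine (ae_restrict_mem measurableSet_Ioi).mono fun t ht ↦ ?_
      have ht0 : 0 < t := hc.trans ht
      rw [norm_mul, norm_mul, norm_mul, ← add_mul]
      gcongr
      rw [Real.norm_of_nonneg (by positivity), Real.norm_of_nonneg (by positivity),
        Real.norm_of_nonneg (by positivity)]
      rcases le_total t 1 with h | h
      · have := Real.rpow_le_rpow_of_exponent_ge ht0 h (show (0 : ℝ) - 1 ≤ p - 1 by
          linarith [hp.1])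
        have := Real.rpow_nonneg ht0.le (δ - 1)
        linarith
      · have := Real.rpow_le_rpow_of_exponent_le h (show p - 1 ≤ δ - 1 by linarith [hp.2])
        have := Real.rpow_nonneg ht0.le ((0 : ℝ) - 1)
        linarith
    · refine (ae_restrict_mem measurableSet_Ioi).mono fun t ht ↦ ?_
      have ht0 : t ≠ 0 := (hc.trans ht).ne'
      have : Continuous fun p : ℝ ↦ t ^ (p - 1) * f t := by
        have : Continuous fun p : ℝ ↦ t ^ (p - 1) :=
          (Real.continuous_const_rpow ht0).comp (by fun_prop)
        fun_prop
      exact (this.tendsto 0).mono_left nhdsWithin_le_nhds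
  -- so is the series without its first term
  have h2 : Tendsto (fun p : ℝ ↦ ∑' m : ℕ, b (m + 1) * (c ^ (p + (m + 1 : ℕ)) / (p + (m + 1 : ℕ))))
      (𝓝[>] 0) (𝓝 (∑' m : ℕ, b (m + 1) * (c ^ ((0 : ℝ) + (m + 1 : ℕ)) / (0 + (m + 1 : ℕ))))) := by
    refine tendsto_tsum_of_dominated_convergence
      (bound := fun m ↦ ‖b (m + 1) * c ^ (m + 1)‖ * 2)
      (((summable_nat_add_iff 1).2 hb.norm).mul_right _) (fun m ↦ ?_) ?_
    · have hm : (0 : ℝ) + (m + 1 : ℕ) ≠ 0 := by positivity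
      have : ContinuousAt
          (fun p : ℝ ↦ b (m + 1) * (c ^ (p + (m + 1 : ℕ)) / (p + (m + 1 : ℕ)))) 0 := by
        have h3 : Continuous fun p : ℝ ↦ c ^ (p + (m + 1 : ℕ)) :=
          (Real.continuous_const_rpow hc.ne').comp (by fun_prop)
        exact continuousAt_const.mul (h3.continuousAt.div (by fun_prop) hm)
      exact this.tendsto.mono_left nhdsWithin_le_nhds
    · have hcp : ∀ᶠ p in 𝓝[>] (0 : ℝ), c ^ p < 2 :=
        (hpow.continuousAt.eventually_lt continuousAt_const (by simp)).filter_mono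
          nhdsWithin_le_nhds
      filter_upwards [hev, hcp] with p hp hcp m
      have hm : (1 : ℝ) ≤ p + (m + 1 : ℕ) := by
        have := hp.1; push_cast; have : (0 : ℝ) ≤ m := m.cast_nonneg; linarith
      rw [Real.rpow_add hc, Real.rpow_natCast, norm_mul, norm_mul, norm_div, norm_mul, mul_assoc]
      gcongr
      rw [Real.norm_of_nonneg (Real.rpow_nonneg hc.le p), Real.norm_of_nonneg (by linarith :
        0 ≤ p + (m + 1 : ℕ))]
      rw [mul_comm]
      refine (div_le_self (by positivity) hm).trans ?_
      gcongr
  have h3 : Tendsto (fun p ↦ finitePart f b c p - b 0 * (c ^ p / p)) (𝓝[>] 0)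
      (𝓝 (finitePart f b c 0)) := by
    have h4 := h1.add h2
    have h5 (p : ℝ) : finitePart f b c p = (∫ t in Ioi c, t ^ (p - 1) * f t) + (b 0 * (c ^ p / p)
        + ∑' m : ℕ, b (m + 1) * (c ^ (p + (m + 1 : ℕ)) / (p + (m + 1 : ℕ)))) := by
      rw [finitePart, (summable_mul_rpow_div hc hb p).tsum_eq_zero_add]; simp
    rw [h5 0]
    simp only [div_zero, mul_zero, zero_add] at h4 ⊢
    refine h4.congr fun p ↦ ?_
    rw [h5 p]; ring
  -- the same function is a difference of two difference quotients
  have h6 : Tendsto (fun p ↦ finitePart f b c p - b 0 * (c ^ p / p)) (𝓝[>] 0)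
      (𝓝 (d - b 0 * Real.log c)) := by
    have h7 := (hderiv.sub (hpow.const_mul (b 0))).tendsto_slope_zero_right
    refine h7.congr' ?_
    filter_upwards [hev] with p hp
    rw [hD p hp]
    have := hp.1.ne'
    simp [hD0]
    field_simp
  linarith [tendsto_nhds_unique h3 h6]

/-! ### Rising factorials and the binomial series -/

lemma rising_zero (a : ℝ) : rising a 0 = 1 := by simp [rising]

lemma rising_succ (a : ℝ) (r : ℕ) : rising a (r + 1) = rising a r * (a + r) :=
  Finset.prod_range_succ _ _

lemma rising_succ_left (a : ℝ) (r : ℕ) : rising a (r + 1) = a * rising (a + 1) r := by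
  rw [rising, Finset.prod_range_succ', rising, mul_comm, Nat.cast_zero, add_zero]
  congr 1
  exact Finset.prod_congr rfl fun i _ ↦ by push_cast; ring

/-- The coefficient `(-1) ^ m (a)_m / m!` of `t ^ m` in `(1 + t) ^ (-a)`. -/
def binCoeff (a : ℝ) (m : ℕ) : ℝ := (-1) ^ m * rising a m / (m.factorial : ℝ)

lemma binCoeff_zero (a : ℝ) : binCoeff a 0 = 1 := by simp [binCoeff, rising_zero]

lemma succ_mul_binCoeff_succ (a : ℝ) (m : ℕ) :
    (m + 1) * binCoeff a (m + 1) = -a * binCoeff (a + 1) m := by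
  rw [binCoeff, binCoeff, rising_succ_left, Nat.factorial_succ]
  have : (m.factorial : ℝ) ≠ 0 := by positivity
  push_cast
  field_simp
  ring

lemma choose_neg_eq_binCoeff (a : ℝ) (m : ℕ) : Ring.choose (-a) m = binCoeff a m := by
  induction m with
  | zero => simp [binCoeff_zero]
  | succ m ih =>
    have h1 := Ring.descPochhammer_eq_factorial_smul_choose (-a) m
    have h2 := Ring.descPochhammer_eq_factorial_smul_choose (-a) (m + 1)
    rw [descPochhammer_succ_right, Polynomial.smeval_mul, h1, ih] at h2
    have hm : ((m + 1).factorial : ℝ) ≠ 0 := by positivity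
    have hm' : (m.factorial : ℝ) ≠ 0 := by positivity
    simp only [nsmul_eq_mul, Polynomial.smeval_sub, Polynomial.smeval_X, pow_one,
      Polynomial.smeval_natCast, pow_zero] at h2
    rw [← mul_right_inj' hm, ← h2, binCoeff, binCoeff, rising_succ]
    field_simp
    ring

lemma hasSum_binCoeff (a : ℝ) {t : ℝ} (ht0 : 0 < t) (ht : t < 1) :
    HasSum (fun m ↦ binCoeff a m * t ^ m) ((1 + t) ^ (-a)) := by
  have h := (Real.one_add_rpow_hasFPowerSeriesOnBall_zero (a := -a)).hasSum (y := t) (by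
    rw [Metric.mem_eball, edist_zero_right, ← ofReal_norm, Real.norm_of_nonneg ht0.le]
    simpa using ht)
  rw [zero_add] at h
  refine h.congr_fun fun m ↦ ?_
  rw [binomialSeries_apply, choose_neg_eq_binCoeff, List.ofFn_const, List.prod_replicate,
    smul_eq_mul]

/-! ### The psi and gamma functions at shifted arguments -/

lemma hasDerivAt_Gamma {x : ℝ} (hx : ∀ m : ℕ, x ≠ -m) :
    HasDerivAt Real.Gamma (Real.Gamma x * psi x) x := by
  rw [psi, mul_div_cancel₀ _ (Real.Gamma_ne_zero hx)]
  exact (Real.differentiableAt_Gamma hx).hasDerivAt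

lemma ne_neg_natCast_of_pos {x : ℝ} (hx : 0 < x) (m : ℕ) : x ≠ -m := by
  have : (0 : ℝ) ≤ m := m.cast_nonneg
  linarith

lemma psi_add_one {x : ℝ} (hx : ∀ m : ℕ, x ≠ -m) : psi (x + 1) = psi x + 1 / x := by
  have hx0 : x ≠ 0 := by simpa using hx 0
  have hx1 (m : ℕ) : x + 1 ≠ -m := fun h ↦ hx (m + 1) (by push_cast; linarith)
  have h1 : HasDerivAt (fun y ↦ Real.Gamma (y + 1)) (Real.Gamma (x + 1) * psi (x + 1)) x :=
    (hasDerivAt_Gamma hx1).comp_add_const x 1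
  have h2 : HasDerivAt (fun y ↦ y * Real.Gamma y)
      (1 * Real.Gamma x + x * (Real.Gamma x * psi x)) x :=
    (hasDerivAt_id x).mul (hasDerivAt_Gamma hx)
  have h3 : (fun y ↦ Real.Gamma (y + 1)) =ᶠ[𝓝 x] fun y ↦ y * Real.Gamma y := by
    filter_upwards [isOpen_ne.mem_nhds hx0] with y hy using Real.Gamma_add_one hy
  have h4 := h1.unique (h2.congr_of_eventuallyEq h3)
  rw [Real.Gamma_add_one hx0] at h4
  have := Real.Gamma_ne_zero hx
  field_simp
  apply mul_left_cancel₀ this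
  linear_combination h4

lemma psi_one : psi 1 = -Real.eulerMascheroniConstant := by
  rw [psi, Real.hasDerivAt_Gamma_one.deriv, Real.Gamma_one, div_one]

lemma psi_one_half : psi (1 / 2) = -Real.eulerMascheroniConstant - 2 * Real.log 2 := by
  rw [psi, Real.hasDerivAt_Gamma_one_half.deriv, Real.Gamma_one_half_eq]
  have : √Real.pi ≠ 0 := (Real.sqrt_pos.2 Real.pi_pos).ne'
  field_simp
  ring

/-- The duplication formula for `ψ` at the integers. -/
lemma two_mul_psi_two_mul_add_one (n : ℕ) :
    2 * psi (2 * n + 1) = psi (n + 1 / 2) + psi (n + 1) + 2 * Real.log 2 := by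
  induction n with
  | zero =>
    simp only [CharP.cast_eq_zero, mul_zero, zero_add, psi_one, psi_one_half]; ring
  | succ n ih =>
    have e1 : 2 * ((n + 1 : ℕ) : ℝ) + 1 = 2 * n + 1 + 1 + 1 := by push_cast; ring
    have e2 : ((n + 1 : ℕ) : ℝ) + 1 / 2 = n + 1 / 2 + 1 := by push_cast; ring
    rw [e1, e2, psi_add_one (x := 2 * (n : ℝ) + 1 + 1) (ne_neg_natCast_of_pos (by positivity)),
      psi_add_one (x := 2 * (n : ℝ) + 1) (ne_neg_natCast_of_pos (by positivity)),
      psi_add_one (x := (n : ℝ) + 1 / 2) (ne_neg_natCast_of_pos (by positivity)), Nat.cast_add_one,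
      psi_add_one (x := (n : ℝ) + 1) (ne_neg_natCast_of_pos (by positivity))]
    have : (n : ℝ) + 1 / 2 ≠ 0 := by positivity
    have : 1 / ((n : ℝ) + 1 / 2) = 2 * (1 / (2 * n + 1)) := by field_simp
    have : 1 / ((n : ℝ) + 1) = 2 * (1 / (2 * n + 1 + 1)) := by field_simp; ring
    linarith

lemma half_sub_natCast_ne (n m : ℕ) : (1 / 2 : ℝ) - n ≠ -m := by
  intro h
  have h1 : ((2 * n : ℕ) : ℝ) = ((2 * m + 1 : ℕ) : ℝ) := by push_cast; linarith
  have := Nat.cast_injective h1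
  omega

/-- The reflection formula for `ψ` at the half-integers. -/
lemma psi_half_sub_natCast (n : ℕ) : psi (1 / 2 - n) = psi (n + 1 / 2) := by
  induction n with
  | zero => simp
  | succ n ih =>
    have h := psi_add_one (half_sub_natCast_ne (n + 1))
    have e1 : (1 / 2 : ℝ) - ((n + 1 : ℕ) : ℝ) + 1 = 1 / 2 - n := by push_cast; ring
    have e2 : ((n + 1 : ℕ) : ℝ) + 1 / 2 = n + 1 / 2 + 1 := by push_cast; ring
    rw [e1, ih] at h
    rw [e2, psi_add_one (ne_neg_natCast_of_pos (by positivity)), h]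
    have e3 : (1 / 2 : ℝ) - ((n + 1 : ℕ) : ℝ) = -(n + 1 / 2) := by push_cast; ring
    rw [e3, div_neg]; ring

lemma Gamma_add_natCast {a : ℝ} (ha : 0 < a) (r : ℕ) :
    Real.Gamma (a + r) = Real.Gamma a * rising a r := by
  induction r with
  | zero => simp [rising_zero]
  | succ r ih =>
    rw [Nat.cast_add_one, ← add_assoc, Real.Gamma_add_one (by positivity), ih, rising_succ]; ring

lemma Gamma_sub_natCast {p : ℝ} (r : ℕ) (hp : ∀ m < r, p ≠ m + 1) :
    Real.Gamma (p - r) * rising (1 - p) r = (-1) ^ r * Real.Gamma p := by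
  induction r with
  | zero => simp [rising_zero]
  | succ r ih =>
    have h := ih fun m hm ↦ hp m (hm.trans r.lt_succ_self)
    have h0 : p - (r + 1 : ℕ) ≠ 0 := fun h0 ↦ hp r r.lt_succ_self (by push_cast at h0; linarith)
    have h1 := Real.Gamma_add_one h0
    have e : p - ((r + 1 : ℕ) : ℝ) + 1 = p - r := by push_cast; ring
    rw [e] at h1
    rw [h1] at h
    rw [rising_succ, pow_succ]
    push_cast at h ⊢
    linear_combination -h

lemma rising_ne_zero {a : ℝ} (r : ℕ) (ha : ∀ m < r, a ≠ -m) : rising a r ≠ 0 :=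
  Finset.prod_ne_zero_iff.2 fun m hm h ↦ ha m (Finset.mem_range.1 hm) (by linarith)

lemma rising_ne_zero_of_pos {a : ℝ} (ha : 0 < a) (r : ℕ) : rising a r ≠ 0 :=
  rising_ne_zero r fun m _ ↦ ne_neg_natCast_of_pos ha m

lemma factorial_two_mul (r : ℕ) :
    ((2 * r).factorial : ℝ) = 4 ^ r * r.factorial * rising (1 / 2) r := by
  induction r with
  | zero => simp [rising_zero]
  | succ r ih =>
    rw [mul_add, mul_one, Nat.factorial_succ, Nat.factorial_succ, Nat.factorial_succ, rising_succ]
    push_cast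
    rw [ih]; ring

lemma factorial_two_mul_add_one (r : ℕ) :
    ((2 * r + 1).factorial : ℝ) = 4 ^ r * r.factorial * rising (3 / 2) r := by
  induction r with
  | zero => simp [rising_zero]
  | succ r ih =>
    rw [show 2 * (r + 1) + 1 = 2 * r + 1 + 1 + 1 by ring, Nat.factorial_succ (2 * r + 1 + 1),
      Nat.factorial_succ (2 * r + 1), Nat.factorial_succ r, rising_succ, Nat.cast_mul,
      Nat.cast_mul, ih]
    push_cast
    ring

lemma rising_add (a : ℝ) (m r : ℕ) : rising a (m + r) = rising a m * rising (a + m) r := by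
  induction r with
  | zero => simp [rising_zero]
  | succ r ih => rw [← add_assoc, rising_succ, ih, rising_succ]; push_cast; ring

/-! ### Finite parts of the beta integral -/

lemma integrableOn_Ioo_beta {p q : ℝ} (hp : 0 < p) (hq : 0 < q) :
    IntegrableOn (fun s : ℝ ↦ s ^ (p - 1) * (1 - s) ^ (q - 1)) (Ioo 0 1) ∧
    ∫ s in Ioo (0 : ℝ) 1, s ^ (p - 1) * (1 - s) ^ (q - 1)
      = Real.Gamma p * Real.Gamma q / Real.Gamma (p + q) := by
  have hcast : ∀ s ∈ Ioo (0 : ℝ) 1, (s : ℂ) ^ ((p : ℂ) - 1) * (1 - (s : ℂ)) ^ ((q : ℂ) - 1)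
      = ((s ^ (p - 1) * (1 - s) ^ (q - 1) : ℝ) : ℂ) := fun s hs ↦ by
    rw [Complex.ofReal_mul, Complex.ofReal_cpow hs.1.le, Complex.ofReal_cpow (sub_pos.2 hs.2).le]
    push_cast; rfl
  have hp' : 0 < (p : ℂ).re := by simpa
  have hq' : 0 < (q : ℂ).re := by simpa
  have h1 := (intervalIntegrable_iff_integrableOn_Ioo_of_le zero_le_one).1
    (Complex.betaIntegral_convergent hp' hq')
  have h2 := Complex.betaIntegral_eq_Gamma_mul_div p q hp' hq'
  rw [Complex.betaIntegral, intervalIntegral.integral_of_le zero_le_one,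
    integral_Ioc_eq_integral_Ioo, setIntegral_congr_fun measurableSet_Ioo hcast,
    integral_complex_ofReal, ← Complex.ofReal_add, Complex.Gamma_ofReal, Complex.Gamma_ofReal,
    Complex.Gamma_ofReal] at h2
  refine ⟨?_, by exact_mod_cast h2⟩
  have h3 := (h1.congr_fun hcast measurableSet_Ioo).re
  rw [IntegrableOn]
  simpa using h3

/-- The beta integral over the half-line, by the substitution `t = s / (1 - s)`. -/
lemma integrableOn_Ioi_beta {p a : ℝ} (hp : 0 < p) (hpa : p < a) :
    IntegrableOn (fun t : ℝ ↦ t ^ (p - 1) * (1 + t) ^ (-a)) (Ioi 0) ∧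
    ∫ t in Ioi (0 : ℝ), t ^ (p - 1) * (1 + t) ^ (-a)
      = Real.Gamma p * Real.Gamma (a - p) / Real.Gamma a := by
  have himage : (fun s : ℝ ↦ s / (1 - s)) '' Ioo 0 1 = Ioi 0 := by
    ext t
    constructor
    · rintro ⟨s, hs, rfl⟩
      exact div_pos hs.1 (sub_pos.2 hs.2)
    · intro (ht : 0 < t)
      refine ⟨t / (1 + t), ⟨by positivity, (div_lt_one (by positivity)).2 (by linarith)⟩, ?_⟩
      field_simp
      ring
  have hderiv : ∀ s ∈ Ioo (0 : ℝ) 1,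
      HasDerivWithinAt (fun s : ℝ ↦ s / (1 - s)) ((1 - s) ^ (-2 : ℝ)) (Ioo 0 1) s := fun s hs ↦ by
    have h1 : 0 < 1 - s := sub_pos.2 hs.2
    refine ((hasDerivAt_id s).div ((hasDerivAt_id s).const_sub 1)
      h1.ne').hasDerivWithinAt.congr_deriv ?_
    rw [Real.rpow_neg h1.le, Real.rpow_two]
    simp only [id]
    field_simp
    ring
  have hinj : InjOn (fun s : ℝ ↦ s / (1 - s)) (Ioo 0 1) := fun s hs s' hs' h ↦ by
    have h1 : 1 - s ≠ 0 := (sub_pos.2 hs.2).ne'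
    have h2 : 1 - s' ≠ 0 := (sub_pos.2 hs'.2).ne'
    simp only at h
    rw [div_eq_div_iff h1 h2] at h
    linarith
  have hcongr : ∀ s ∈ Ioo (0 : ℝ) 1, |(1 - s) ^ (-2 : ℝ)| •
      ((s / (1 - s)) ^ (p - 1) * (1 + s / (1 - s)) ^ (-a))
      = s ^ (p - 1) * (1 - s) ^ (a - p - 1) := fun s hs ↦ by
    have h1 : 0 < 1 - s := sub_pos.2 hs.2
    have h2 : 1 + s / (1 - s) = (1 - s)⁻¹ := by field_simp; ring
    rw [h2, abs_of_pos (by positivity), smul_eq_mul, Real.div_rpow hs.1.le h1.le,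
      Real.inv_rpow h1.le, ← Real.rpow_neg h1.le, neg_neg, div_eq_mul_inv, ← Real.rpow_neg h1.le]
    rw [show a - p - 1 = -2 + (-(p - 1) + a) by ring, Real.rpow_add h1, Real.rpow_add h1]
    ring
  obtain ⟨h1, h2⟩ := integrableOn_Ioo_beta hp (sub_pos.2 hpa)
  rw [add_sub_cancel] at h2
  constructor
  · rw [← himage, integrableOn_image_iff_integrableOn_abs_deriv_smul measurableSet_Ioo hderiv hinj]
    exact h1.congr_fun (fun s hs ↦ (hcongr s hs).symm) measurableSet_Ioo
  · rw [← himage, integral_image_eq_integral_abs_deriv_smul measurableSet_Ioo hderiv hinj,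
      setIntegral_congr_fun measurableSet_Ioo hcongr, h2]

lemma one_add_rpow_neg_le {t a : ℝ} (ht : 0 < t) (ha : 0 < a) : (1 + t) ^ (-a) ≤ t ^ (-a) :=
  Real.rpow_le_rpow_of_nonpos ht (by linarith) (by linarith)

lemma integrableOn_Ioi_rpow_mul_one_add_rpow {p a c : ℝ} (hc : 0 < c) (ha : 0 < a) (hpa : p < a) :
    IntegrableOn (fun t : ℝ ↦ t ^ (p - 1) * (1 + t) ^ (-a)) (Ioi c) := by
  refine Integrable.mono' (integrableOn_Ioi_rpow_of_lt (show p - 1 - a < -1 by linarith) hc)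
    (by fun_prop : Measurable fun t : ℝ ↦ t ^ (p - 1) * (1 + t) ^ (-a)).aestronglyMeasurable
    ((ae_restrict_mem measurableSet_Ioi).mono fun t ht ↦ ?_)
  have ht0 : 0 < t := hc.trans ht
  rw [Real.norm_of_nonneg (by positivity), sub_eq_add_neg (p - 1) a, Real.rpow_add ht0]
  exact mul_le_mul_of_nonneg_left (one_add_rpow_neg_le ht0 ha) (by positivity)

lemma tendsto_rpow_mul_one_add_rpow {p a : ℝ} (ha : 0 < a) (hpa : p < a) :
    Tendsto (fun t : ℝ ↦ t ^ p * (1 + t) ^ (-a)) atTop (𝓝 0) := by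
  refine squeeze_zero' (g := fun t : ℝ ↦ t ^ (-(a - p))) ?_ ?_
    (tendsto_rpow_neg_atTop (sub_pos.2 hpa))
  · filter_upwards [eventually_gt_atTop 0] with t ht
    positivity
  · filter_upwards [eventually_gt_atTop 0] with t ht
    rw [show -(a - p) = p + -a by ring, Real.rpow_add ht]
    exact mul_le_mul_of_nonneg_left (one_add_rpow_neg_le ht ha) (by positivity)

/-- The finite part at `p` of the integral of `t ^ (p - 1) * (1 + t) ^ (-a)` over the half-line. -/
def betaPart (a c p : ℝ) : ℝ := finitePart (fun t ↦ (1 + t) ^ (-a)) (binCoeff a) c p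

lemma betaPart_of_pos {a c p : ℝ} (hc : 0 < c) (hc1 : c < 1) (hp : 0 < p) (hpa : p < a) :
    betaPart a c p = Real.Gamma p * Real.Gamma (a - p) / Real.Gamma a := by
  obtain ⟨h1, h2⟩ := integrableOn_Ioi_beta hp hpa
  rw [betaPart, finitePart_eq_integral hc hp (fun t ht ↦ hasSum_binCoeff a ht.1
    (ht.2.trans_lt hc1)) h1, h2]

/-- Integration by parts, with `(1 + t) ^ (-a)` differentiated. -/
lemma mul_betaPart {a c p : ℝ} (hc : 0 < c) (hc1 : c < 1) (ha : 0 < a) (hpa : p < a) :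
    p * betaPart a c p - a * betaPart (a + 1) c (p + 1)
      = -∑' m : ℕ, if p + m = 0 then binCoeff a m else 0 := by
  have hpa' : p + 1 < a + 1 := by linarith
  have h1 := hasSum_binCoeff a hc hc1
  have h2 := hasSum_binCoeff (a + 1) hc hc1
  have hint := integrableOn_Ioi_rpow_mul_one_add_rpow hc (by linarith : 0 < a + 1) hpa'
  have h3 := mul_finitePart_add_finitePart_deriv (f := fun t ↦ (1 + t) ^ (-a))
    (f' := fun t ↦ -a * (1 + t) ^ (-(a + 1))) (b := binCoeff a)
    (b' := fun m ↦ -a * binCoeff (a + 1) m) (p := p) hc h1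
    ((h2.summable.mul_left (-a)).congr fun m ↦ by ring)
    (fun m ↦ (succ_mul_binCoeff_succ a m).symm)
    (fun t ht ↦ by
      have ht0 : 1 + t ≠ 0 := by have : 0 < t := hc.trans_le ht; positivity
      refine (((hasDerivAt_id t).const_add 1).rpow_const (p := -a) (Or.inl ht0)).congr_deriv ?_
      rw [one_mul, id, neg_add'])
    (integrableOn_Ioi_rpow_mul_one_add_rpow hc ha hpa)
    ((hint.const_mul (-a)).congr (Eventually.of_forall fun t ↦ by
      simp only [add_sub_cancel_right]; ring))
    (tendsto_rpow_mul_one_add_rpow ha hpa)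
  rw [← h3, betaPart, betaPart, sub_eq_add_neg]
  congr 1
  rw [finitePart, finitePart, ← neg_mul, mul_add, ← integral_const_mul, ← tsum_mul_left]
  congr 1
  · congr 1; ext t; ring
  · congr 1; ext m; ring

/-- Away from the poles the finite part is the analytic continuation of the beta integral. The
recursion `mul_betaPart`, shared by both sides, reduces this to positive `p`. -/
lemma betaPart_of_ne {a c p : ℝ} (hc : 0 < c) (hc1 : c < 1) (ha : 0 < a) (hpa : p < a)
    (hp : ∀ m : ℕ, p ≠ -m) :
    betaPart a c p = Real.Gamma p * Real.Gamma (a - p) / Real.Gamma a := by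
  obtain ⟨j, hj⟩ := exists_nat_gt (-p)
  induction j generalizing a p with
  | zero => exact betaPart_of_pos hc hc1 (by simpa using hj) hpa
  | succ j ih =>
    have hp0 : p ≠ 0 := by simpa using hp 0
    have h1 := mul_betaPart hc hc1 ha hpa
    have h2 : ∀ m : ℕ, (if p + m = 0 then binCoeff a m else 0) = 0 := fun m ↦
      if_neg fun h ↦ hp m (by linarith)
    rw [tsum_congr h2, tsum_zero, ih (by linarith : 0 < a + 1) (by linarith)
      (fun m h ↦ hp (m + 1) (by push_cast; linarith)) (by push_cast at hj; linarith),
      Real.Gamma_add_one hp0, Real.Gamma_add_one ha.ne', add_sub_add_right_eq_sub] at h1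
    have hG := (Real.Gamma_pos_of_pos ha).ne'
    rw [eq_div_iff hG]
    apply mul_left_cancel₀ hp0
    field_simp at h1
    linear_combination h1

/-- The constant term at the pole `p = 0`: the derivative of `p B(p, a - p)` there. -/
lemma betaPart_zero {a c : ℝ} (hc : 0 < c) (hc1 : c < 1) (ha : 0 < a) :
    betaPart a c 0 + Real.log c = psi 1 - psi a := by
  have hG := (Real.Gamma_pos_of_pos ha).ne'
  have h1 : HasDerivAt (fun p ↦ Real.Gamma (p + 1)) (Real.Gamma 1 * psi 1) 0 := by
    refine HasDerivAt.comp_add_const 0 1 ?_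
    rw [zero_add]
    exact hasDerivAt_Gamma (ne_neg_natCast_of_pos one_pos)
  have h2 : HasDerivAt (fun p ↦ Real.Gamma (a - p)) (-(Real.Gamma a * psi a)) 0 := by
    refine HasDerivAt.comp_const_sub a 0 ?_
    rw [sub_zero]
    exact hasDerivAt_Gamma (ne_neg_natCast_of_pos ha)
  have h3 := finitePart_zero_add_log (f := fun t ↦ (1 + t) ^ (-a)) (b := binCoeff a)
    (D := fun p ↦ Real.Gamma (p + 1) * Real.Gamma (a - p) / Real.Gamma a) hc (half_pos ha)
    (hasSum_binCoeff a hc hc1).summable (integrableOn_Ioi_rpow_mul_one_add_rpow hc ha ha)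
    (integrableOn_Ioi_rpow_mul_one_add_rpow hc ha (half_lt_self ha))
    (fun p hp ↦ by
      have := hp.1.ne'
      refine (betaPart_of_pos hc hc1 hp.1 (hp.2.trans (half_lt_self ha))).trans ?_
      rw [Real.Gamma_add_one this]
      field_simp)
    (by simp [binCoeff_zero, hG]) ((h1.mul h2).div_const _)
  rw [binCoeff_zero, one_mul] at h3
  rw [betaPart, h3]
  simp only [zero_add, sub_zero, Real.Gamma_one]
  field_simp
  ring

lemma tsum_ite_neg_natCast_add_eq_zero (b : ℕ → ℝ) (n : ℕ) :
    (∑' m : ℕ, if -(n : ℝ) + m = 0 then b m else 0) = b n := by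
  rw [tsum_eq_single n fun m hm ↦ if_neg fun h ↦ hm (Nat.cast_injective (R := ℝ) (by linarith))]
  simp

/-- The constant term of the beta integral at the pole `p = -n`. -/
lemma betaPart_neg_natCast {a c : ℝ} (hc : 0 < c) (hc1 : c < 1) (ha : 0 < a) (n : ℕ) :
    betaPart a c (-n) + binCoeff a n * Real.log c = binCoeff a n * (psi (n + 1) - psi (a + n)) := by
  induction n generalizing a with
  | zero => simpa [binCoeff_zero] using betaPart_zero hc hc1 ha
  | succ n ih =>
    have h1 := mul_betaPart hc hc1 ha (p := -((n + 1 : ℕ) : ℝ)) (by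
      have : (0 : ℝ) ≤ (n + 1 : ℕ) := Nat.cast_nonneg _
      linarith)
    rw [tsum_ite_neg_natCast_add_eq_zero] at h1
    have h2 := ih (a := a + 1) (by linarith)
    have h3 := succ_mul_binCoeff_succ a n
    have e : -((n + 1 : ℕ) : ℝ) + 1 = -n := by push_cast; ring
    have e' : a + ((n + 1 : ℕ) : ℝ) = a + 1 + n := by push_cast; ring
    rw [e] at h1
    rw [e', Nat.cast_add_one,
      psi_add_one (x := (n : ℝ) + 1) (ne_neg_natCast_of_pos (by positivity))]
    push_cast at h1 ⊢
    have hn : (n : ℝ) + 1 ≠ 0 := by positivity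
    apply mul_left_cancel₀ hn
    have h4 : ((n : ℝ) + 1) * (1 / (n + 1)) = 1 := by field_simp
    linear_combination -h1 - a * h2 + (Real.log c - psi (n + 1) + psi (a + 1 + n)) * h3
      - binCoeff a (n + 1) * h4

/-! ### Finite parts of the gamma integral -/

/-- The coefficient `(-1) ^ m / m!` of `t ^ m` in `exp (-t)`. -/
def expCoeff (m : ℕ) : ℝ := (-1) ^ m / (m.factorial : ℝ)

lemma expCoeff_zero : expCoeff 0 = 1 := by simp [expCoeff]

lemma succ_mul_expCoeff_succ (m : ℕ) : (m + 1) * expCoeff (m + 1) = -expCoeff m := by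
  rw [expCoeff, expCoeff, Nat.factorial_succ]
  have : (m.factorial : ℝ) ≠ 0 := by positivity
  push_cast
  field_simp
  ring

lemma hasSum_expCoeff (t : ℝ) : HasSum (fun m ↦ expCoeff m * t ^ m) (Real.exp (-t)) := by
  have h := NormedSpace.expSeries_div_hasSum_exp (-t)
  rw [← Real.exp_eq_exp_ℝ] at h
  refine h.congr_fun fun m ↦ ?_
  rw [expCoeff, neg_pow]; ring

/-- The finite part at `p` of the integral of `t ^ (p - 1) * exp (-t)` over the half-line. -/
def gammaPart (c p : ℝ) : ℝ := finitePart (fun t ↦ Real.exp (-t)) expCoeff c p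

lemma integrableOn_Ioi_rpow_mul_exp_neg {c : ℝ} (hc : 0 < c) (s : ℝ) :
    IntegrableOn (fun t : ℝ ↦ t ^ s * Real.exp (-t)) (Ioi c) := by
  refine integrable_of_isBigO_exp_neg (half_pos one_pos) (fun t ht ↦ ?_) ?_
  · have ht0 : t ≠ 0 := (hc.trans_le ht).ne'
    exact ((Real.continuousAt_rpow_const t s (Or.inl ht0)).mul
      (by fun_prop)).continuousWithinAt
  · simpa only [mul_comm] using (Real.Gamma_integrand_isLittleO s).isBigO

lemma gammaPart_zero {c : ℝ} (hc : 0 < c) : gammaPart c 0 + Real.log c = psi 1 := by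
  have h1 : HasDerivAt (fun p ↦ Real.Gamma (p + 1)) (Real.Gamma 1 * psi 1) 0 := by
    refine HasDerivAt.comp_add_const 0 1 ?_
    rw [zero_add]
    exact hasDerivAt_Gamma (ne_neg_natCast_of_pos one_pos)
  have h3 := finitePart_zero_add_log (f := fun t ↦ Real.exp (-t)) (b := expCoeff)
    (D := fun p ↦ Real.Gamma (p + 1)) hc one_pos
    (hasSum_expCoeff c).summable (integrableOn_Ioi_rpow_mul_exp_neg hc _)
    (integrableOn_Ioi_rpow_mul_exp_neg hc _)
    (fun p hp ↦ by
      have := hp.1.ne'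
      have hI := Real.GammaIntegral_convergent hp.1
      rw [finitePart_eq_integral hc hp.1 (fun t _ ↦ hasSum_expCoeff t)
        (hI.congr (Eventually.of_forall fun t ↦ mul_comm _ _)), Real.Gamma_add_one this,
        mul_div_cancel_left₀ _ this, Real.Gamma_eq_integral hp.1]
      congr 1; ext t; ring)
    (by simp [expCoeff_zero]) h1
  rw [expCoeff_zero, one_mul, Real.Gamma_one, one_mul] at h3
  exact h3

/-- The constant term of the gamma integral at the pole `p = -n`. -/
lemma gammaPart_neg_natCast {c : ℝ} (hc : 0 < c) (n : ℕ) :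
    gammaPart c (-n) + expCoeff n * Real.log c = expCoeff n * psi (n + 1) := by
  induction n with
  | zero => simpa [expCoeff_zero] using gammaPart_zero hc
  | succ n ih =>
    have h1 := mul_finitePart_add_finitePart_deriv (f := fun t ↦ Real.exp (-t))
      (f' := fun t ↦ -Real.exp (-t)) (b := expCoeff)
      (b' := fun m ↦ -expCoeff m) (p := -((n + 1 : ℕ) : ℝ)) hc (hasSum_expCoeff c)
      ((hasSum_expCoeff c).summable.neg.congr fun m ↦ by ring)
      (fun m ↦ (succ_mul_expCoeff_succ m).symm)
      (fun t _ ↦ (hasDerivAt_neg t).exp.congr_deriv (by ring))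
      (integrableOn_Ioi_rpow_mul_exp_neg hc _)
      ((integrableOn_Ioi_rpow_mul_exp_neg hc (-((n + 1 : ℕ) : ℝ))).neg.congr
        (Eventually.of_forall fun t ↦ by simp))
      (by
        simpa using tendsto_rpow_mul_exp_neg_mul_atTop_nhds_zero (-((n + 1 : ℕ) : ℝ)) 1 one_pos)
    have h2 : finitePart (fun t ↦ -Real.exp (-t)) (fun m ↦ -expCoeff m) c
        (-((n + 1 : ℕ) : ℝ) + 1) = -gammaPart c (-n) := by
      have e : -((n + 1 : ℕ) : ℝ) + 1 = -n := by push_cast; ring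
      simp only [e, gammaPart, finitePart, mul_neg, neg_mul, integral_neg, tsum_neg, neg_add]
    rw [tsum_ite_neg_natCast_add_eq_zero, h2] at h1
    have h3 := succ_mul_expCoeff_succ n
    rw [gammaPart] at ih ⊢
    rw [Nat.cast_add_one, psi_add_one (x := (n : ℝ) + 1) (ne_neg_natCast_of_pos (by positivity))]
    push_cast at h1 ⊢
    have hn : (n : ℝ) + 1 ≠ 0 := by positivity
    apply mul_left_cancel₀ hn
    have h4 : ((n : ℝ) + 1) * (1 / (n + 1)) = 1 := by field_simp
    rw [gammaPart] at h1
    linear_combination -h1 - ih + (Real.log c - psi (n + 1)) * h3 - expCoeff (n + 1) * h4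

/-! ### The two expansions of the scaled integral -/

/-- The substitution `v = y * t ^ (-1 / 2)`. -/
lemma integral_Ioc_rpow_mul_exp_neg {c y : ℝ} (hc : 0 < c) (hy : 0 < y) (s : ℝ) :
    ∫ t in Ioc 0 c, t ^ s * Real.exp (-(y * t ^ (-(1 / 2) : ℝ)))
      = 2 * y ^ (2 * s + 2) *
        ∫ v in Ioi (y * c ^ (-(1 / 2) : ℝ)), v ^ (-(2 * s + 2) - 1) * Real.exp (-v) := by
  have himage : (fun t : ℝ ↦ y * t ^ (-(1 / 2) : ℝ)) '' Ioo 0 c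
      = Ioi (y * c ^ (-(1 / 2) : ℝ)) := by
    ext v
    constructor
    · rintro ⟨t, ht, rfl⟩
      exact mul_lt_mul_of_pos_left (Real.rpow_lt_rpow_of_neg ht.1 ht.2 (by norm_num)) hy
    · intro (hv : _ < v)
      have hv0 : 0 < v := lt_trans (by positivity) hv
      have hvy : c ^ (-(1 / 2) : ℝ) < v / y := by rwa [lt_div_iff₀' hy]
      have h1 := Real.rpow_lt_rpow_of_neg (by positivity) hvy (show (-2 : ℝ) < 0 by norm_num)
      rw [← Real.rpow_mul hc.le, show (-(1 / 2) : ℝ) * -2 = 1 by norm_num, Real.rpow_one] at h1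
      refine ⟨(v / y) ^ (-2 : ℝ), ⟨by positivity, h1⟩, ?_⟩
      simp only
      rw [← Real.rpow_mul (by positivity)]
      norm_num
      field_simp
  have hderiv : ∀ t ∈ Ioo (0 : ℝ) c, HasDerivWithinAt (fun t : ℝ ↦ y * t ^ (-(1 / 2) : ℝ))
      (y * (-(1 / 2) * t ^ (-(1 / 2) - 1 : ℝ))) (Ioo 0 c) t := fun t ht ↦
    ((Real.hasDerivAt_rpow_const (Or.inl ht.1.ne')).const_mul y).hasDerivWithinAt
  have hinj : InjOn (fun t : ℝ ↦ y * t ^ (-(1 / 2) : ℝ)) (Ioo 0 c) := fun t ht t' ht' h ↦ by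
    have h1 : t ^ (-(1 / 2) : ℝ) = t' ^ (-(1 / 2) : ℝ) := mul_left_cancel₀ hy.ne' h
    exact (Real.rpow_left_inj ht.1.le ht'.1.le (by norm_num)).1 h1
  rw [← integral_const_mul, ← himage,
    integral_image_eq_integral_abs_deriv_smul measurableSet_Ioo hderiv hinj,
    integral_Ioc_eq_integral_Ioo]
  refine setIntegral_congr_fun measurableSet_Ioo fun t ht ↦ ?_
  have ht0 : 0 < t := ht.1
  have habs : |y * (-(1 / 2) * t ^ (-(1 / 2) - 1 : ℝ))| = y * (1 / 2 * t ^ (-(1 / 2) - 1 : ℝ)) := by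
    rw [neg_mul, mul_neg, abs_neg, abs_of_pos (by positivity)]
  simp only [smul_eq_mul]
  rw [habs, Real.mul_rpow hy.le (by positivity), ← Real.rpow_mul ht0.le]
  have h1 : y ^ (2 * s + 2) * y ^ (-(2 * s + 2) - 1) * y = 1 := by
    rw [← Real.rpow_add hy]
    nth_rewrite 2 [← Real.rpow_one y]
    rw [← Real.rpow_add hy]
    ring_nf
    exact Real.rpow_zero y
  have h2 : t ^ (-(1 / 2) - 1 : ℝ) * t ^ (-(1 / 2) * (-(2 * s + 2) - 1)) = t ^ s := by
    rw [← Real.rpow_add ht0]; ring_nf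
  rw [← h2]
  linear_combination -(t ^ (-(1 / 2) - 1 : ℝ) * t ^ (-(1 / 2) * (-(2 * s + 2) - 1)) *
    Real.exp (-(y * t ^ (-(1 / 2) : ℝ)))) * h1

/-- The exponent `p = ν + 1 - k / 2` of the beta integral that multiplies `y ^ k`. -/
def expo (ν k : ℕ) : ℝ := ν + 1 - k / 2

/-- The term of indices `m`, `k` of the double series that both expansions share. It is `0` when
`k = 2 (ν + 1 + m)`, where the denominator vanishes. -/
def doubleTerm (ν : ℕ) (a c y : ℝ) (m k : ℕ) : ℝ :=
  binCoeff a m * (expCoeff k * y ^ k * (c ^ (expo ν k + m) / (expo ν k + m)))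

/-- A non-zero half-integer is at least `1 / 2` in absolute value. -/
lemma abs_inv_expo_add_natCast_le (ν k m : ℕ) : |(expo ν k + m)⁻¹| ≤ 2 := by
  have h : expo ν k + m = ((2 * (ν + 1 + m) - k : ℤ) : ℝ) / 2 := by
    rw [expo]; push_cast; ring
  rw [h, inv_div, abs_div, abs_two]
  rcases eq_or_ne (2 * (ν + 1 + m) - k : ℤ) 0 with h0 | h0
  · rw [h0]; norm_num
  · have : (1 : ℝ) ≤ |((2 * (ν + 1 + m) - k : ℤ) : ℝ)| := by
      rw [← Int.cast_abs]; exact_mod_cast Int.one_le_abs h0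
    exact div_le_self two_pos.le this

lemma rpow_expo {t : ℝ} (ht : 0 < t) (ν k : ℕ) :
    t ^ (expo ν k - 1) = t ^ ν * (t ^ (-(1 / 2) : ℝ)) ^ k := by
  rw [← Real.rpow_natCast, ← Real.rpow_natCast, ← Real.rpow_mul ht.le, ← Real.rpow_add ht, expo]
  ring_nf

lemma summable_doubleTerm {ν : ℕ} {a c y : ℝ} (hc : 0 < c) (hc1 : c < 1) :
    Summable fun x : ℕ × ℕ ↦ doubleTerm ν a c y x.1 x.2 := by
  have h1 := (hasSum_binCoeff a hc hc1).summable.norm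
  have h2 := ((hasSum_expCoeff (y * c ^ (-(1 / 2) : ℝ))).summable.norm.mul_right
    (c ^ ν * c * 2))
  refine Summable.of_norm_bounded (h1.mul_of_nonneg h2 (fun _ ↦ norm_nonneg _)
    fun _ ↦ by positivity) fun ⟨m, k⟩ ↦ ?_
  have h3 : c ^ (expo ν k + m) = c ^ ν * (c ^ (-(1 / 2) : ℝ)) ^ k * c * c ^ m := by
    rw [← rpow_expo hc, ← Real.rpow_natCast c m, ← Real.rpow_add_one hc.ne', ← Real.rpow_add hc]
    ring_nf
  have h4 : doubleTerm ν a c y m k = (binCoeff a m * c ^ m) *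
      ((expCoeff k * (y * c ^ (-(1 / 2) : ℝ)) ^ k) * (c ^ ν * c * (expo ν k + m)⁻¹)) := by
    rw [doubleTerm, h3]; ring
  have h5 : ‖c ^ ν * c * (expo ν k + m)⁻¹‖ ≤ c ^ ν * c * 2 := by
    rw [norm_mul, Real.norm_of_nonneg (by positivity)]
    exact mul_le_mul_of_nonneg_left (abs_inv_expo_add_natCast_le ν k m) (by positivity)
  rw [h4, norm_mul, norm_mul (expCoeff k * _)]
  exact mul_le_mul_of_nonneg_left (mul_le_mul_of_nonneg_left h5 (norm_nonneg _)) (norm_nonneg _)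

/-- The integrand in the variable `t = (α - 1) x`, with `a = 1 / (α - 1)` and `y = 2 √z`. -/
def scaledIntegrand (ν : ℕ) (a y t : ℝ) : ℝ :=
  t ^ ν * (1 + t) ^ (-a) * Real.exp (-(y * t ^ (-(1 / 2) : ℝ)))

lemma integrableOn_scaledIntegrand {ν : ℕ} {a y : ℝ} (ha : (ν : ℝ) + 1 < a) (hy : 0 < y) :
    IntegrableOn (scaledIntegrand ν a y) (Ioi 0) := by
  have h := (integrableOn_Ioi_beta (p := (ν : ℝ) + 1) (by positivity) ha).1
  refine Integrable.mono' h (by unfold scaledIntegrand; fun_prop)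
    ((ae_restrict_mem measurableSet_Ioi).mono fun t (ht : 0 < t) ↦ ?_)
  rw [scaledIntegrand, add_sub_cancel_right, Real.rpow_natCast, Real.norm_of_nonneg (by positivity)]
  refine mul_le_of_le_one_right (by positivity) (Real.exp_le_one_iff.2 ?_)
  have : 0 < y * t ^ (-(1 / 2) : ℝ) := by positivity
  linarith

/-- Far from the origin the exponential is expanded in powers of `y`. -/
lemma hasSum_integral_Ioi {ν : ℕ} {a c y : ℝ} (hc : 0 < c) (ha : (ν : ℝ) + 1 < a) :
    HasSum (fun k ↦ expCoeff k * y ^ k * ∫ t in Ioi c, t ^ (expo ν k - 1) * (1 + t) ^ (-a))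
      (∫ t in Ioi c, scaledIntegrand ν a y t) := by
  have ha0 : 0 < a := lt_trans (by positivity) ha
  have hint (k : ℕ) : IntegrableOn (fun t : ℝ ↦ t ^ (expo ν k - 1) * (1 + t) ^ (-a)) (Ioi c) := by
    refine integrableOn_Ioi_rpow_mul_one_add_rpow hc ha0 ?_
    have : (0 : ℝ) ≤ k := k.cast_nonneg
    rw [expo]; linarith
  have hle (k : ℕ) : ∫ t in Ioi c, t ^ (expo ν k - 1) * (1 + t) ^ (-a)
      ≤ (c ^ (-(1 / 2) : ℝ)) ^ k * ∫ t in Ioi c, t ^ (expo ν 0 - 1) * (1 + t) ^ (-a) := by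
    rw [← integral_const_mul]
    refine setIntegral_mono_on (hint k) ((hint 0).const_mul _) measurableSet_Ioi fun t ht ↦ ?_
    have ht0 : 0 < t := hc.trans ht
    have h1 : t ^ (-(1 / 2) : ℝ) ≤ c ^ (-(1 / 2) : ℝ) :=
      Real.rpow_le_rpow_of_nonpos hc (le_of_lt ht) (by norm_num)
    have h2 := pow_le_pow_left₀ (by positivity) h1 k
    rw [rpow_expo ht0, rpow_expo ht0, pow_zero, mul_one]
    calc t ^ ν * (t ^ (-(1 / 2) : ℝ)) ^ k * (1 + t) ^ (-a)
        = (t ^ (-(1 / 2) : ℝ)) ^ k * (t ^ ν * (1 + t) ^ (-a)) := by ring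
      _ ≤ _ := mul_le_mul_of_nonneg_right h2 (by positivity)
  have hnonneg (k : ℕ) : 0 ≤ ∫ t in Ioi c, t ^ (expo ν k - 1) * (1 + t) ^ (-a) :=
    setIntegral_nonneg measurableSet_Ioi fun t ht ↦ by
      have ht0 : 0 < t := hc.trans ht
      positivity
  have key := hasSum_integral_of_summable_integral_norm (μ := volume.restrict (Ioi c))
    (F := fun (k : ℕ) (t : ℝ) ↦ expCoeff k * y ^ k * (t ^ (expo ν k - 1) * (1 + t) ^ (-a)))
    (fun k ↦ (hint k).const_mul _) (by
      refine Summable.of_nonneg_of_le (fun k ↦ integral_nonneg fun t ↦ norm_nonneg _) (fun k ↦ ?_)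
        ((hasSum_expCoeff (y * c ^ (-(1 / 2) : ℝ))).summable.norm.mul_right
          (∫ t in Ioi c, t ^ (expo ν 0 - 1) * (1 + t) ^ (-a)))
      have h1 : ∫ t in Ioi c, ‖expCoeff k * y ^ k * (t ^ (expo ν k - 1) * (1 + t) ^ (-a))‖
          = ‖expCoeff k * y ^ k‖ * ∫ t in Ioi c, t ^ (expo ν k - 1) * (1 + t) ^ (-a) := by
        rw [← integral_const_mul]
        refine setIntegral_congr_fun measurableSet_Ioi fun t ht ↦ ?_
        have ht0 : 0 < t := hc.trans ht
        rw [norm_mul, Real.norm_of_nonneg (by positivity : 0 ≤ t ^ (expo ν k - 1) * (1 + t) ^ (-a))]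
      rw [h1, mul_pow, ← mul_assoc, norm_mul _ ((c ^ (-(1 / 2) : ℝ)) ^ k), mul_assoc,
        Real.norm_of_nonneg (by positivity : 0 ≤ (c ^ (-(1 / 2) : ℝ)) ^ k)]
      exact mul_le_mul_of_nonneg_left (hle k) (norm_nonneg _))
  have hval : ∀ t ∈ Ioi c, ∑' k, expCoeff k * y ^ k * (t ^ (expo ν k - 1) * (1 + t) ^ (-a))
      = scaledIntegrand ν a y t := fun t ht ↦ by
    have ht0 : 0 < t := hc.trans ht
    rw [scaledIntegrand, ← (hasSum_expCoeff _).tsum_eq, ← tsum_mul_left]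
    refine tsum_congr fun k ↦ ?_
    rw [rpow_expo ht0]; ring
  simp only [integral_const_mul] at key
  rwa [setIntegral_congr_fun measurableSet_Ioi hval] at key

/-- Near the origin the binomial factor is expanded in powers of `t`. -/
lemma hasSum_integral_Ioc {ν : ℕ} {a c y : ℝ} (hc : 0 < c) (hc1 : c < 1) (hy : 0 < y) :
    HasSum (fun m : ℕ ↦ binCoeff a m *
        ∫ t in Ioc 0 c, t ^ ((ν + m : ℕ) : ℝ) * Real.exp (-(y * t ^ (-(1 / 2) : ℝ))))
      (∫ t in Ioc 0 c, scaledIntegrand ν a y t) := by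
  have hexp {t : ℝ} (ht : 0 < t) : Real.exp (-(y * t ^ (-(1 / 2) : ℝ))) ≤ 1 := by
    have : 0 < y * t ^ (-(1 / 2) : ℝ) := by positivity
    exact Real.exp_le_one_iff.2 (by linarith)
  have hbound (m : ℕ) : ∀ t ∈ Ioc 0 c,
      ‖t ^ ((ν + m : ℕ) : ℝ) * Real.exp (-(y * t ^ (-(1 / 2) : ℝ)))‖ ≤ c ^ m := fun t ht ↦ by
    have ht0 : 0 < t := ht.1
    rw [Real.rpow_natCast, Real.norm_of_nonneg (by positivity), pow_add]
    calc t ^ ν * t ^ m * Real.exp (-(y * t ^ (-(1 / 2) : ℝ))) ≤ 1 * c ^ m * 1 := by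
          gcongr
          · exact pow_le_one₀ ht0.le (ht.2.trans hc1.le)
          · exact ht.2
          · exact hexp ht0
      _ = c ^ m := by ring
  have hint (m : ℕ) : IntegrableOn
      (fun t ↦ t ^ ((ν + m : ℕ) : ℝ) * Real.exp (-(y * t ^ (-(1 / 2) : ℝ)))) (Ioc 0 c) :=
    Measure.integrableOn_of_bounded (M := c ^ m) (by simp) (by fun_prop)
      ((ae_restrict_mem measurableSet_Ioc).mono (hbound m))
  have key := hasSum_integral_of_summable_integral_norm (μ := volume.restrict (Ioc 0 c))
    (F := fun (m : ℕ) (t : ℝ) ↦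
      binCoeff a m * (t ^ ((ν + m : ℕ) : ℝ) * Real.exp (-(y * t ^ (-(1 / 2) : ℝ)))))
    (fun m ↦ (hint m).const_mul _) (by
      refine Summable.of_nonneg_of_le (fun k ↦ integral_nonneg fun t ↦ norm_nonneg _) (fun m ↦ ?_)
        ((hasSum_binCoeff a hc hc1).summable.norm.mul_right c)
      simp only [norm_mul (binCoeff a m)]
      rw [integral_const_mul, mul_assoc]
      refine mul_le_mul_of_nonneg_left ?_ (norm_nonneg _)
      refine (setIntegral_mono_on (hint m).norm (integrableOn_const (by simp))
        measurableSet_Ioc (hbound m)).trans_eq ?_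
      rw [Real.norm_of_nonneg (by positivity)]
      simp [hc.le, mul_comm])
  have hval : ∀ t ∈ Ioc 0 c,
      ∑' m, binCoeff a m * (t ^ ((ν + m : ℕ) : ℝ) * Real.exp (-(y * t ^ (-(1 / 2) : ℝ))))
      = scaledIntegrand ν a y t := fun t ht ↦ by
    rw [scaledIntegrand, ← (hasSum_binCoeff a ht.1 (ht.2.trans_lt hc1)).tsum_eq, ← tsum_mul_left,
      ← tsum_mul_right]
    refine tsum_congr fun m ↦ ?_
    rw [Real.rpow_natCast, pow_add]; ring
  simp only [integral_const_mul] at key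
  rwa [setIntegral_congr_fun measurableSet_Ioc hval] at key

/-- The contribution of the gamma finite parts: the `m`-th term of the expansion near the origin
without the double series. -/
def logPart (ν : ℕ) (a c y : ℝ) (m : ℕ) : ℝ :=
  binCoeff a m * (y ^ (2 * (m + (ν + 1))) / ((2 * (m + (ν + 1))).factorial : ℝ)) *
    (2 * psi (2 * (m + (ν + 1) : ℕ) + 1) - 2 * Real.log y + Real.log c)

/-- The `m`-th term of the expansion near the origin. With `n = ν + 1 + m`, it is an incomplete gamma
integral of exponent `-2 n`, that is, a finite part minus a series in the cut-off
`y * c ^ (-1 / 2)`. -/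
lemma binCoeff_mul_integral_Ioc {ν : ℕ} {a c y : ℝ} (hc : 0 < c) (hy : 0 < y) (m : ℕ) :
    binCoeff a m * ∫ t in Ioc 0 c, t ^ ((ν + m : ℕ) : ℝ) * Real.exp (-(y * t ^ (-(1 / 2) : ℝ)))
      = logPart ν a c y m + ∑' k, doubleTerm ν a c y m k := by
  set n := m + (ν + 1) with hn
  have hx : 0 < y * c ^ (-(1 / 2) : ℝ) := by positivity
  have h1 := gammaPart_neg_natCast hx (2 * n)
  have e1 : 2 * ((ν + m : ℕ) : ℝ) + 2 = ((2 * n : ℕ) : ℝ) := by rw [hn]; push_cast; ring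
  have e2 : expCoeff (2 * n) = 1 / ((2 * n).factorial : ℝ) := by simp [expCoeff, pow_mul]
  have e3 : Real.log (y * c ^ (-(1 / 2) : ℝ)) = Real.log y - 1 / 2 * Real.log c := by
    rw [Real.log_mul hy.ne' (by positivity), Real.log_rpow hc]; ring
  have h2 (k : ℕ) : binCoeff a m * (2 * y ^ (2 * n) *
      (expCoeff k * ((y * c ^ (-(1 / 2) : ℝ)) ^ (-((2 * n : ℕ) : ℝ) + k)
        / (-((2 * n : ℕ) : ℝ) + k)))) = -doubleTerm ν a c y m k := by
    have e4 : -((2 * n : ℕ) : ℝ) + k = -2 * (expo ν k + m) := by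
      rw [hn, expo]; push_cast; ring
    have e5 : y ^ (2 * n) * (y * c ^ (-(1 / 2) : ℝ)) ^ (-((2 * n : ℕ) : ℝ) + k)
        = y ^ k * c ^ (expo ν k + m) := by
      rw [Real.mul_rpow hy.le (by positivity), ← Real.rpow_mul hc.le, ← mul_assoc,
        ← Real.rpow_natCast y (2 * n), ← Real.rpow_add hy, add_neg_cancel_left, Real.rpow_natCast,
        e4]
      ring_nf
    have e6 : (-((2 * n : ℕ) : ℝ) + k)⁻¹ = -(1 / 2) * (expo ν k + m)⁻¹ := by
      rw [e4, mul_inv]; norm_num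
    rw [doubleTerm, div_eq_mul_inv (_ ^ (-((2 * n : ℕ) : ℝ) + k)), e6, div_eq_mul_inv (c ^ _)]
    linear_combination (-(binCoeff a m * expCoeff k * (expo ν k + m)⁻¹)) * e5
  rw [integral_Ioc_rpow_mul_exp_neg hc hy, e1, Real.rpow_natCast]
  have h3 : ∑' k, doubleTerm ν a c y m k = -(binCoeff a m * (2 * y ^ (2 * n) *
      ∑' k : ℕ, expCoeff k * ((y * c ^ (-(1 / 2) : ℝ)) ^ (-((2 * n : ℕ) : ℝ) + k)
        / (-((2 * n : ℕ) : ℝ) + k)))) := by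
    rw [← tsum_mul_left, ← tsum_mul_left, ← tsum_neg]
    exact tsum_congr fun k ↦ by rw [h2 k, neg_neg]
  rw [gammaPart, finitePart, e2, e3] at h1
  rw [h3, logPart, ← hn]
  push_cast at h1 ⊢
  linear_combination (binCoeff a m * (2 * y ^ (2 * n))) * h1

/-- The contribution of the beta finite parts: the `k`-th term of the expansion far from the origin
completed by a row of the double series. -/
def powPart (ν : ℕ) (a c y : ℝ) (k : ℕ) : ℝ := expCoeff k * y ^ k * betaPart a c (expo ν k)

/-- The two expansions combined. The double series enters them with opposite signs and cancels. -/
lemma exists_hasSum_powPart_logPart {ν : ℕ} {a c y : ℝ} (hc : 0 < c) (hc1 : c < 1)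
    (ha : (ν : ℝ) + 1 < a) (hy : 0 < y) :
    ∃ W V, HasSum (powPart ν a c y) W ∧ HasSum (logPart ν a c y) V ∧
      ∫ t in Ioi 0, scaledIntegrand ν a y t = W + V := by
  have hT := summable_doubleTerm (ν := ν) (a := a) (y := y) hc hc1
  have hT' : Summable fun x : ℕ × ℕ ↦ doubleTerm ν a c y x.2 x.1 := hT.prod_symm
  have h1 := hT.hasSum.prod_fiberwise fun m ↦ (hT.prod_factor m).hasSum
  have h2 := hT'.hasSum.prod_fiberwise fun k ↦ (hT'.prod_factor k).hasSum
  have hswap : ∑' x : ℕ × ℕ, doubleTerm ν a c y x.2 x.1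
      = ∑' x : ℕ × ℕ, doubleTerm ν a c y x.1 x.2 :=
    (Equiv.prodComm ℕ ℕ).tsum_eq fun x : ℕ × ℕ ↦ doubleTerm ν a c y x.1 x.2
  rw [hswap] at h2
  have hI := integrableOn_scaledIntegrand ha hy
  have h3 := (hasSum_integral_Ioi (y := y) hc ha).add h2
  have h4 := (hasSum_integral_Ioc (ν := ν) (a := a) hc hc1 hy).sub h1
  refine ⟨_, _, h3.congr_fun fun k ↦ ?_, h4.congr_fun fun m ↦ ?_, ?_⟩
  · rw [powPart, betaPart, finitePart, mul_add, ← tsum_mul_left]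
    congr 1
    exact tsum_congr fun m ↦ by rw [doubleTerm]; ring
  · rw [binCoeff_mul_integral_Ioc hc hy]; ring
  · rw [← Ioc_union_Ioi_eq_Ioi hc.le, setIntegral_union (Ioc_disjoint_Ioi le_rfl) measurableSet_Ioi
      (hI.mono_set Ioc_subset_Ioi_self) (hI.mono_set (Ioi_subset_Ioi hc.le))]
    ring

/-! ### Identification of the three parts -/

lemma tsum_eq_sum_range_even_add_odd {Q : ℕ → ℝ} (hQ : Summable Q) (N : ℕ) :
    Summable (fun r ↦ Q (2 * r + 1)) ∧ Summable (fun r ↦ Q (2 * (r + N))) ∧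
    ∑' k, Q k = ∑ r ∈ Finset.range N, Q (2 * r) + ∑' r, Q (2 * r + 1)
      + ∑' r, Q (2 * (r + N)) := by
  have he : Summable fun r ↦ Q (2 * r) :=
    hQ.comp_injective (i := fun r ↦ 2 * r) fun _ _ h ↦ by simpa using h
  have ho : Summable fun r ↦ Q (2 * r + 1) :=
    hQ.comp_injective (i := fun r ↦ 2 * r + 1) fun _ _ h ↦ by simpa using h
  refine ⟨ho, (summable_nat_add_iff (f := fun r ↦ Q (2 * r)) N).2 he, ?_⟩
  rw [← tsum_even_add_odd he ho, ← he.sum_add_tsum_nat_add N]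
  ring

/-- The powers of `y` sorted into even ones below `2 (ν + 1)`, odd ones, and the remaining even ones,
at which the beta integral has its poles. -/
lemma integral_scaledIntegrand_eq {ν : ℕ} {a c y : ℝ} (hc : 0 < c) (hc1 : c < 1)
    (ha : (ν : ℝ) + 1 < a) (hy : 0 < y) :
    Summable (fun r ↦ powPart ν a c y (2 * r + 1)) ∧
    Summable (fun r ↦ powPart ν a c y (2 * (r + (ν + 1))) + logPart ν a c y r) ∧
    ∫ t in Ioi 0, scaledIntegrand ν a y t
      = ∑ r ∈ Finset.range (ν + 1), powPart ν a c y (2 * r)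
        + ∑' r, powPart ν a c y (2 * r + 1)
        + ∑' r, (powPart ν a c y (2 * (r + (ν + 1))) + logPart ν a c y r) := by
  obtain ⟨W, V, hW, hV, h⟩ := exists_hasSum_powPart_logPart hc hc1 ha hy
  obtain ⟨ho, he, hsum⟩ := tsum_eq_sum_range_even_add_odd hW.summable (ν + 1)
  refine ⟨ho, he.add hV.summable, ?_⟩
  rw [h, ← hW.tsum_eq, ← hV.tsum_eq, hsum, he.tsum_add hV.summable]
  ring

lemma two_mul_sqrt_pow_two_mul {z : ℝ} (hz : 0 < z) (r : ℕ) :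
    (2 * √z) ^ (2 * r) = 4 ^ r * z ^ r := by
  rw [pow_mul, mul_pow, Real.sq_sqrt hz.le, mul_pow]; norm_num

lemma expCoeff_two_mul (r : ℕ) : expCoeff (2 * r) = 1 / ((2 * r).factorial : ℝ) := by
  simp [expCoeff, pow_mul]

lemma expCoeff_two_mul_add_one (r : ℕ) :
    expCoeff (2 * r + 1) = -(1 / ((2 * r + 1).factorial : ℝ)) := by
  simp [expCoeff, pow_succ, pow_mul, neg_div]

lemma expCoeff_mul_pow_two_mul {z : ℝ} (hz : 0 < z) (r : ℕ) :
    expCoeff (2 * r) * (2 * √z) ^ (2 * r) = z ^ r / ((r.factorial : ℝ) * rising (1 / 2) r) := by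
  rw [expCoeff_two_mul, two_mul_sqrt_pow_two_mul hz, factorial_two_mul]
  have := rising_ne_zero_of_pos (half_pos one_pos) r
  have : (r.factorial : ℝ) ≠ 0 := by positivity
  field_simp

lemma expCoeff_mul_pow_two_mul_add_one {z : ℝ} (hz : 0 < z) (r : ℕ) :
    expCoeff (2 * r + 1) * (2 * √z) ^ (2 * r + 1)
      = -2 * √z * (z ^ r / ((r.factorial : ℝ) * rising (3 / 2) r)) := by
  rw [expCoeff_two_mul_add_one, pow_succ, two_mul_sqrt_pow_two_mul hz, factorial_two_mul_add_one]
  have := rising_ne_zero_of_pos (show (0 : ℝ) < 3 / 2 by norm_num) r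
  have : (r.factorial : ℝ) ≠ 0 := by positivity
  field_simp

/-- Even powers below the poles give the terms of the finite sum. -/
lemma powPart_two_mul {ν : ℕ} {a c z : ℝ} (hc : 0 < c) (hc1 : c < 1) (ha : (ν : ℝ) + 1 < a)
    (hz : 0 < z) {r : ℕ} (hr : r < ν + 1) :
    powPart ν a c (2 * √z) (2 * r) = Real.Gamma (a - 1 - ν) * Real.Gamma (1 + ν) / Real.Gamma a *
      ((-1) ^ r / (r.factorial : ℝ) *
        (rising (a - 1 - ν) r / (rising (1 / 2) r * rising (-(ν : ℝ)) r)) * z ^ r) := by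
  have hr' : (r : ℝ) < ν + 1 := by exact_mod_cast hr
  have hr0 : (0 : ℝ) ≤ r := r.cast_nonneg
  have e1 : expo ν (2 * r) = ν + 1 - r := by rw [expo]; push_cast; ring
  have e2 : a - ((ν : ℝ) + 1 - r) = a - 1 - ν + r := by ring
  have h1 := Gamma_sub_natCast (p := (ν : ℝ) + 1) r fun m hm h ↦ by
    have : ν = m := Nat.cast_injective (R := ℝ) (by linarith)
    omega
  have h2 : rising (-(ν : ℝ)) r ≠ 0 := rising_ne_zero r fun m hm h ↦ by
    have : ν = m := Nat.cast_injective (R := ℝ) (by linarith)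
    omega
  rw [show 1 - ((ν : ℝ) + 1) = -ν by ring] at h1
  rw [powPart, e1, betaPart_of_pos hc hc1 (by linarith) (by linarith), e2,
    Gamma_add_natCast (by linarith), eq_div_of_mul_eq h2 h1, expCoeff_mul_pow_two_mul hz,
    add_comm (ν : ℝ) 1]
  have := rising_ne_zero_of_pos (half_pos one_pos) r
  have : (r.factorial : ℝ) ≠ 0 := by positivity
  field_simp

/-- Odd powers give the terms of the `₁F₂` series. -/
lemma powPart_two_mul_add_one {ν : ℕ} {a c z : ℝ} (hc : 0 < c) (hc1 : c < 1)
    (ha : (ν : ℝ) + 1 < a) (hz : 0 < z) (r : ℕ) :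
    powPart ν a c (2 * √z) (2 * r + 1)
      = -2 * Real.Gamma (a - 1 / 2 - ν) * Real.Gamma (1 / 2 + ν) * √z / Real.Gamma a *
        oneFTwoTerm (a - 1 / 2 - ν) (3 / 2) (1 / 2 - ν) (-z) r := by
  have hr0 : (0 : ℝ) ≤ r := r.cast_nonneg
  have hν0 : (0 : ℝ) ≤ ν := ν.cast_nonneg
  have e1 : expo ν (2 * r + 1) = 1 / 2 + ν - r := by rw [expo]; push_cast; ring
  have e2 : a - (1 / 2 + (ν : ℝ) - r) = a - 1 / 2 - ν + r := by ring
  have h0 (m : ℕ) : 1 / 2 + (ν : ℝ) ≠ m + 1 := fun h ↦ half_sub_natCast_ne (m + 1) ν (by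
    push_cast; linarith)
  have h1 := Gamma_sub_natCast (p := 1 / 2 + (ν : ℝ)) r fun m _ ↦ h0 m
  have e3 : 1 - (1 / 2 + (ν : ℝ)) = 1 / 2 - ν := by ring
  rw [e3] at h1
  have h2 : rising (1 / 2 - (ν : ℝ)) r ≠ 0 := rising_ne_zero r fun m _ ↦ half_sub_natCast_ne ν m
  have h3 (m : ℕ) : 1 / 2 + (ν : ℝ) - r ≠ -m := fun h ↦ half_sub_natCast_ne r (m + ν) (by
    push_cast; linarith)
  rw [powPart, e1, betaPart_of_ne hc hc1 (by linarith) (by linarith) h3, e2,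
    Gamma_add_natCast (by linarith), eq_div_of_mul_eq h2 h1, expCoeff_mul_pow_two_mul_add_one hz,
    oneFTwoTerm, neg_pow z]
  have := rising_ne_zero_of_pos (show (0 : ℝ) < 3 / 2 by norm_num) r
  have : (r.factorial : ℝ) ≠ 0 := by positivity
  field_simp

/-- Even powers at the poles give the terms of the logarithmic series. The two occurrences of
`log c` cancel; the duplication formula absorbs `log y = log 2 + log z / 2`, and reflection turns
`ψ(n + 1 / 2)` into `ψ(1 / 2 - n)`. -/
lemma powPart_add_logPart {ν : ℕ} {α c z : ℝ} (hc : 0 < c) (hc1 : c < 1) (hα : 1 < α)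
    (hz : 0 < z) (r : ℕ) :
    powPart ν (1 / (α - 1)) c (2 * √z) (2 * (r + (ν + 1)))
        + logPart ν (1 / (α - 1)) c (2 * √z) r
      = (√Real.pi)⁻¹ / Real.Gamma (1 / (α - 1)) * z ^ (1 + ν) * logTerm ν α z r := by
  have ha0 : 0 < 1 / (α - 1) := one_div_pos.2 (sub_pos.2 hα)
  have hG := (Real.Gamma_pos_of_pos ha0).ne'
  have hπ : √Real.pi ≠ 0 := (Real.sqrt_pos.2 Real.pi_pos).ne'
  set n := r + (ν + 1) with hn
  have e1 : expo ν (2 * n) = -r := by rw [expo, hn]; push_cast; ring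
  have hlog : Real.log (2 * √z) = Real.log 2 + Real.log z / 2 := by
    rw [Real.log_mul two_ne_zero (Real.sqrt_pos.2 hz).ne', Real.log_sqrt hz.le]
  have hA : A ν α r = psi (n + 1 / 2) - psi (1 / (α - 1) + r) + psi (r + 1) + psi (n + 1) := by
    rw [A, ← psi_half_sub_natCast, hn]
    push_cast
    ring_nf
  have hB : binCoeff (1 / (α - 1)) r * (z ^ n / ((n.factorial : ℝ) * rising (1 / 2) n))
      = (√Real.pi)⁻¹ / Real.Gamma (1 / (α - 1)) * z ^ (1 + ν) * (z ^ r * B ν α r) := by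
    have h1 := Gamma_sub_natCast (p := 1 / 2) (ν + 1) fun m _ h ↦
      half_sub_natCast_ne (m + 1) 0 (by push_cast; linarith)
    have e2 : (1 / 2 : ℝ) - (ν + 1 : ℕ) = -(1 / 2) - ν := by push_cast; ring
    have e3 : (1 / 2 : ℝ) + (ν + 1 : ℕ) = 3 / 2 + ν := by push_cast; ring
    have h2 := rising_ne_zero_of_pos (half_pos one_pos) (ν + 1)
    rw [e2, show (1 : ℝ) - 1 / 2 = 1 / 2 by norm_num, Real.Gamma_one_half_eq] at h1
    have e4 : n = ν + 1 + r := by rw [hn, add_comm]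
    rw [B, eq_div_of_mul_eq h2 h1, e4, rising_add, e3, binCoeff, add_comm 1 ν]
    have h3 := rising_ne_zero_of_pos (show (0 : ℝ) < 3 / 2 + ν by positivity) r
    generalize rising (3 / 2 + (ν : ℝ)) r = S at h3 ⊢
    generalize rising (1 / (α - 1)) r = R
    have : (r.factorial : ℝ) ≠ 0 := by positivity
    have : ((ν + 1 + r).factorial : ℝ) ≠ 0 := by positivity
    have hs : ((-1 : ℝ) ^ (ν + 1)) * (-1) ^ (ν + 1) = 1 := by rw [← mul_pow]; simp
    field_simp
    rw [pow_add (-1 : ℝ) (ν + 1) r, pow_add z (ν + 1) r]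
    linear_combination -(R * (-1 : ℝ) ^ r * z ^ (ν + 1) * z ^ r) * hs
  have h1 := betaPart_neg_natCast hc hc1 ha0 r
  have h2 := two_mul_psi_two_mul_add_one n
  have h3 := expCoeff_mul_pow_two_mul hz n
  rw [expCoeff_two_mul, one_div_mul_eq_div] at h3
  rw [powPart, logPart, ← hn, e1, expCoeff_two_mul, one_div_mul_eq_div, h3, logTerm, hA, hlog]
  linear_combination (z ^ n / ((n.factorial : ℝ) * rising (1 / 2) n)) * h1
    + binCoeff (1 / (α - 1)) r * (z ^ n / ((n.factorial : ℝ) * rising (1 / 2) n)) * h2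
    + (-Real.log z + (psi (n + 1 / 2) - psi (1 / (α - 1) + r) + psi (r + 1) + psi (n + 1))) * hB

lemma integrand_eq {ν : ℕ} {α b x : ℝ} (hα : 1 < α) (hb : 0 < b) (hx : 0 < x) :
    integrand ν α b x = ((α - 1) ^ ν)⁻¹ *
      scaledIntegrand ν (1 / (α - 1)) (2 * √((α - 1) * b ^ 2 / 4)) ((α - 1) * x) := by
  have h0 : 0 < α - 1 := sub_pos.2 hα
  have h1 : 2 * √((α - 1) * b ^ 2 / 4) = b * (α - 1) ^ (1 / 2 : ℝ) := by
    rw [← Real.sqrt_eq_rpow, show (α - 1) * b ^ 2 / 4 = (α - 1) * (b / 2) ^ 2 by ring,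
      Real.sqrt_mul h0.le, Real.sqrt_sq (by positivity)]
    ring
  have h2 : (α - 1) ^ (1 / 2 : ℝ) * (α - 1) ^ (-(1 / 2) : ℝ) = 1 := by
    rw [← Real.rpow_add h0, add_neg_cancel, Real.rpow_zero]
  have h3 : 2 * √((α - 1) * b ^ 2 / 4) * ((α - 1) * x) ^ (-(1 / 2) : ℝ)
      = b * x ^ (-(1 / 2) : ℝ) := by
    rw [h1, Real.mul_rpow h0.le hx.le]
    linear_combination b * x ^ (-(1 / 2) : ℝ) * h2
  rw [integrand, scaledIntegrand, h3, mul_pow, neg_mul]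
  field_simp

end Thermonuclear

end

theorem mainTheorem2 (ν : ℕ) (hν : 0 < ν) (b α z : ℝ) (hb : 0 < b) (hα : 1 < α)
    (hconv : α < 1 + 1 / ((ν : ℝ) + 1)) (hz : z = (α - 1) * b ^ 2 / 4) :
    IntegrableOn (Thermonuclear.integrand ν α b) (Ioi (0 : ℝ)) ∧
    Summable (Thermonuclear.oneFTwoTerm (1 / (α - 1) - 1 / 2 - ν) (3 / 2) (1 / 2 - ν) (-z)) ∧
    Summable (Thermonuclear.logTerm ν α z) ∧
    Thermonuclear.I₁ ν α b =
      (Real.sqrt Real.pi)⁻¹ / ((α - 1) ^ (ν + 1) * Real.Gamma (1 / (α - 1))) *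
        (Real.sqrt Real.pi * Real.Gamma (1 / (α - 1) - 1 - ν) * Real.Gamma (1 + ν) *
            (∑ r ∈ Finset.range (ν + 1),
              (-1) ^ r / (r.factorial : ℝ) *
                (Thermonuclear.rising (1 / (α - 1) - 1 - ν) r /
                  (Thermonuclear.rising (1 / 2) r * Thermonuclear.rising (-(ν : ℝ)) r)) * z ^ r)
          - 2 * Real.sqrt Real.pi * Real.Gamma (1 / (α - 1) - 1 / 2 - ν) *
              Real.Gamma (1 / 2 + ν) * Real.sqrt z *
              Thermonuclear.oneFTwo (1 / (α - 1) - 1 / 2 - ν) (3 / 2) (1 / 2 - ν) (-z)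
          + z ^ (1 + ν) * ∑' r : ℕ, Thermonuclear.logTerm ν α z r) := by
  have h0 : 0 < α - 1 := sub_pos.2 hα
  have hz0 : 0 < z := by rw [hz]; positivity
  have ha : (ν : ℝ) + 1 < 1 / (α - 1) := by
    rw [lt_div_comm₀ (by positivity) h0]; linarith
  have hG := (Real.Gamma_pos_of_pos (one_div_pos.2 h0)).ne'
  have hs : 0 < √z := Real.sqrt_pos.2 hz0
  have hπ : √Real.pi ≠ 0 := (Real.sqrt_pos.2 Real.pi_pos).ne'
  have hcongr : ∀ x ∈ Ioi (0 : ℝ), Thermonuclear.integrand ν α b x = ((α - 1) ^ ν)⁻¹ *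
      Thermonuclear.scaledIntegrand ν (1 / (α - 1)) (2 * √z) ((α - 1) * x) := fun x hx ↦ by
    rw [hz]; exact Thermonuclear.integrand_eq hα hb hx
  have hint := Thermonuclear.integrableOn_scaledIntegrand ha (y := 2 * √z) (by positivity)
  -- any cut-off `c` in `(0, 1)` would do
  obtain ⟨hodd, hlog, hI⟩ := Thermonuclear.integral_scaledIntegrand_eq (c := 1 / 2) (by norm_num)
    (by norm_num) ha (y := 2 * √z) (by positivity)
  have hodd_eq := Thermonuclear.powPart_two_mul_add_one (c := 1 / 2) (by norm_num) (by norm_num)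
    ha hz0
  have hlog_eq := Thermonuclear.powPart_add_logPart (ν := ν) (c := 1 / 2) (by norm_num)
    (by norm_num) hα hz0
  have heven : ∑ r ∈ Finset.range (ν + 1),
      Thermonuclear.powPart ν (1 / (α - 1)) (1 / 2) (2 * √z) (2 * r) = _ :=
    Finset.sum_congr rfl fun r hr ↦ Thermonuclear.powPart_two_mul (by norm_num) (by norm_num) ha
      hz0 (Finset.mem_range.1 hr)
  rw [funext hodd_eq] at hodd
  rw [funext hlog_eq] at hlog
  have hG1 : Real.Gamma (1 / (α - 1) - 1 / 2 - ν) ≠ 0 :=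
    (Real.Gamma_pos_of_pos (by linarith)).ne'
  have hG2 : Real.Gamma (1 / 2 + (ν : ℝ)) ≠ 0 := (Real.Gamma_pos_of_pos (by positivity)).ne'
  refine ⟨?_, ?_, ?_, ?_⟩
  · refine IntegrableOn.congr_fun ?_ (fun x hx ↦ (hcongr x hx).symm) measurableSet_Ioi
    refine Integrable.const_mul ?_ _
    exact (integrableOn_Ioi_comp_mul_left_iff _ 0 h0).2 (by rwa [mul_zero])
  · refine (summable_mul_left_iff ?_).1 hodd
    exact div_ne_zero (mul_ne_zero (mul_ne_zero (mul_ne_zero (by norm_num) hG1) hG2) hs.ne') hG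
  · refine (summable_mul_left_iff ?_).1 hlog
    have := hz0.ne'
    positivity
  · rw [tsum_congr hodd_eq, tsum_congr hlog_eq, heven, ← Finset.mul_sum, tsum_mul_left,
      tsum_mul_left] at hI
    rw [Thermonuclear.I₁, setIntegral_congr_fun measurableSet_Ioi hcongr, integral_const_mul,
      integral_comp_mul_left_Ioi _ 0 h0, mul_zero, hI, Thermonuclear.oneFTwo, smul_eq_mul, pow_succ]
    field_simp
    ring
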